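/- For rational numbers $a,b,c$ with $c\notin\{0,-1,-2,\dots\}$ let $F(a,b;c\,|\,z)=\sum_{n\ge 0}\frac{(a)_n(b)_n}{(c)_n\,n!}z^n$ be the Gauss hypergeometric series, where $(x)_n=x(x+1)\cdots(x+n-1)$, and let $$\mathcal Y(t)=\begin{pmatrix} F(\tfrac13,\tfrac23;\tfrac12\,|\,t^2) & -\tfrac13\,t\,F(\tfrac76,\tfrac56;\tfrac32\,|\,t^2)\\ -\tfrac23\,t\,F(\tfrac23,\tfrac43;\tfrac32\,|\,t^2) & F(\tfrac16,\tfrac56;\tfrac12\,|\,t^2) \end{pmatrix}.$$ For $k\ge 1$ let $\mathcal Y_k(t)$ be the $k$-th truncation of $\mathcal Y(t)$, obtained by deleting in every entry all terms of degree $\ge k$ in $t$; $\mathcal Y_k(t^p)$ denotes the result of substituting $t^p$ for $t$ in $\mathcal Y_k(t)$. Let $p>3$ be a prime, and put $\epsilon_p=1$ if $3$ is a square modulo $p$ and $\epsilon_p=-1$ if not. Then $\mathcal Y(t)$ has entries in $\mathbb Z_p[[t]]$, the matrices $\mathcal Y(t^p)$ and $\mathcal Y_{mp^{s-1}}(t^p)$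 are invertible over $\mathbb Z_p[[t]]$ for all integers $m,s\ge 1$, and for all integers $m,s\ge1$ we have $$\mathcal Y_{mp^s}(t)\begin{pmatrix}\epsilon_p&0\\0&1\end{pmatrix}\mathcal Y_{mp^{s-1}}(t^p)^{-1}\equiv \mathcal Y(t)\begin{pmatrix}\epsilon_p&0\\0&1\end{pmatrix}\mathcal Y(t^p)^{-1}\pmod{p^s},$$ that is, every entry of the difference of the two sides lies in $p^s\,\mathbb Z_p[[t]]$. -/

import Mathlib

open scoped PowerSeries

noncomputable section

/-- The Gauss hypergeometric series `F(a, b; c | z) = ∑ (a)ₙ (b)ₙ / ((c)ₙ n!) zⁿ`, as a formal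
power series in `z` with rational coefficients. -/
def gaussSeries (a b c : ℚ) : ℚ⟦X⟧ :=
  PowerSeries.mk fun n => ordinaryHypergeometricCoefficient a b c n

/-- `F(a, b; c | t²)` as a formal power series in `t`. -/
def gaussSeriesSq (a b c : ℚ) : ℚ⟦X⟧ :=
  PowerSeries.expand 2 two_ne_zero (gaussSeries a b c)

/-- The matrix `𝒴(t)`. -/
def hyperMatrix : Matrix (Fin 2) (Fin 2) ℚ⟦X⟧ :=
  !![gaussSeriesSq (1 / 3) (2 / 3) (1 / 2),
      PowerSeries.C (-(1 / 3) : ℚ) * PowerSeries.X * gaussSeriesSq (7 / 6) (5 / 6) (3 / 2);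
    PowerSeries.C (-(2 / 3) : ℚ) * PowerSeries.X * gaussSeriesSq (2 / 3) (4 / 3) (3 / 2),
      gaussSeriesSq (1 / 6) (5 / 6) (1 / 2)]

/-- The truncation of a matrix of power series: in every entry, all terms of degree `≥ n` are
dropped. -/
def truncMatrix {R : Type*} [CommRing R] (n : ℕ) (A : Matrix (Fin 2) (Fin 2) R⟦X⟧) :
    Matrix (Fin 2) (Fin 2) R⟦X⟧ :=
  A.map fun f => (PowerSeries.trunc n f : R⟦X⟧)

/-- The substitution `A(t) ↦ A(tᵏ)` (for `k ≠ 0`) in a matrix of power series. -/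
def expandMatrix {R : Type*} [CommRing R] (k : ℕ) (hk : k ≠ 0)
    (A : Matrix (Fin 2) (Fin 2) R⟦X⟧) : Matrix (Fin 2) (Fin 2) R⟦X⟧ :=
  A.map fun f => PowerSeries.expand k hk f

/-- The matrix `diag(ε_p, 1)`, where `ε_p` is `1` if `3` is a square modulo `p` and `-1` if not. -/
def epsMatrix (p : ℕ) (R : Type*) [CommRing R] : Matrix (Fin 2) (Fin 2) R⟦X⟧ :=
  open Classical in
  !![if IsSquare (3 : ZMod p) then 1 else -1, 0; 0, 1]

/-- Congruence of matrices of power series modulo the ideal generated by `N`. -/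
def MatrixCongr {R : Type*} [CommRing R] (N : ℕ) (A B : Matrix (Fin 2) (Fin 2) R⟦X⟧) : Prop :=
  ∀ i j, (N : R⟦X⟧) ∣ A i j - B i j

end

open PowerSeries

noncomputable section

/-! ### Divisibility and derivatives of power series -/

namespace PowerSeries

/-! Write t = sin x, s = sin(x/3), c = cos(x/3). Then 𝒴 is algebraic: its entries are rational in s
and c with denominators 1 - 4s² and c (`trisectionMatrix`). Both matrices solve the same first order
system with value 1 at t = 0, so they agree. Since s and c exist over ℤ_p by Hensel's lemma when p >
3, this also gives integrality.

Put V_N = 𝒴⁻¹ · (𝒴 - 𝒴_N)/t^N, so that 𝒴_N = 𝒴(1 - t^N V_N), and let E = diag(ε_p, 1). If V_{pM} E ≡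
E V_M(t^p) mod p^s, then modulo p^s both 𝒴_{pM} E and E-twisted 𝒴_M(t^p) carry the same right factor
1 - t^{pM} V_M(t^p), which cancels in the quotient (`matrixCongr_of_shift`).

The congruence for V comes from its generating series, the kernel (𝒴(τ)⁻¹𝒴(σ) - 1)/(σ - τ) in a
second variable σ. Up to the unit 2, its diagonal entries are integral combinations of logarithmic
derivatives in σ of units, and its off-diagonal entries are √3 times such combinations
(`kernel_zero_zero` to `kernel_one_one`). Coefficients of logarithmic derivatives satisfy Dwork's
congruences for any Frobenius lift (`pow_dvd_coeff_dlog_sub`). On ℤ_p[√3] the lift sends √3 to ε_p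
√3, and this is the source of E. -/

theorem natCast_dvd_iff_coeff {R : Type*} [CommRing R] {n : ℕ} {f : R⟦X⟧} :
    (n : R⟦X⟧) ∣ f ↔ ∀ k, (n : R) ∣ coeff k f := by
  constructor
  · rintro ⟨g, rfl⟩ k
    rw [← map_natCast (C (R := R)) n, coeff_C_mul]
    exact dvd_mul_right _ _
  · intro h
    choose g hg using h
    refine ⟨mk g, ?_⟩
    ext k
    rw [← map_natCast (C (R := R)) n, coeff_C_mul, coeff_mk, hg]

theorem natCast_mem_nonZeroDivisors {R : Type*} [CommRing R] {n : ℕ}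
    (h : (n : R) ∈ nonZeroDivisors R) : (n : R⟦X⟧) ∈ nonZeroDivisors R⟦X⟧ := by
  rw [mem_nonZeroDivisors_iff_right] at h ⊢
  intro f hf
  ext k
  apply h
  have := congrArg (coeff k) hf
  rwa [← map_natCast (C (R := R)) n, coeff_mul_C] at this

theorem derivative_expand {R : Type*} [CommRing R] (p : ℕ) (hp : p ≠ 0) (f : R⟦X⟧) :
    d⁄dX R (expand p hp f) = (p : R⟦X⟧) * X ^ (p - 1) * expand p hp (d⁄dX R f) := by
  rw [expand_apply, expand_apply, derivative_subst (HasSubst.X_pow hp), derivative_pow,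
    derivative_X]
  ring

theorem derivative_map {R S : Type*} [CommRing R] [CommRing S] (F : R →+* S) (f : R⟦X⟧) :
    d⁄dX S (map F f) = map F (d⁄dX R f) := by
  ext n
  simp [coeff_derivative]

end PowerSeries


/-! ### Frobenius lifts -/

/-- A ring endomorphism lifting the `p`-th power map modulo `p`. -/
def IsFrobeniusLift {R : Type*} [CommRing R] (p : ℕ) (F : R →+* R) : Prop :=
  ∀ x, (p : R) ∣ F x - x ^ p

/-- The endomorphism of `R⟦X⟧` acting by `F` on coefficients and by `X ↦ X ^ p`. -/
def expandMap {R : Type*} [CommRing R] (p : ℕ) (hp : p ≠ 0) (F : R →+* R) : R⟦X⟧ →+* R⟦X⟧ :=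
  (expand p hp : R⟦X⟧ →ₐ[R] R⟦X⟧).toRingHom.comp (PowerSeries.map F)

theorem expandMap_apply {R : Type*} [CommRing R] (p : ℕ) (hp : p ≠ 0) (F : R →+* R) (f : R⟦X⟧) :
    expandMap p hp F f = expand p hp (PowerSeries.map F f) := rfl

theorem IsFrobeniusLift.expandMap {R : Type*} [CommRing R] {p : ℕ} [Fact p.Prime] (hp : p ≠ 0)
    {F : R →+* R} (hF : IsFrobeniusLift p F) : IsFrobeniusLift p (expandMap p hp F) := by
  intro f
  -- If p is a unit, R/p is zero and does not have characteristic p. Otherwise F reduces to the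
  -- Frobenius of R/p, and in characteristic p the p-th power of a series is Frobenius on
  -- coefficients with X ↦ X^p.
  by_cases hu : IsUnit (p : R)
  · have : IsUnit (p : R⟦X⟧) := by
      rw [← map_natCast (C (R := R)) p]
      exact hu.map C
    exact this.dvd
  have := CharP.quotient R p hu
  let π := Ideal.Quotient.mk (Ideal.span {(p : R)})
  have hπ : π.comp F = (frobenius _ p).comp π := by
    ext x
    have h := hF x
    rw [← Ideal.mem_span_singleton, ← Ideal.Quotient.mk_eq_mk_iff_sub_mem] at h
    simpa [frobenius_def] using h
  rw [natCast_dvd_iff_coeff]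
  intro k
  rw [← Ideal.mem_span_singleton, ← Ideal.Quotient.eq_zero_iff_mem]
  change π _ = 0
  rw [← coeff_map, map_sub, map_pow, expandMap_apply, map_expand, ← RingHom.comp_apply (map π),
    ← map_comp, hπ, map_comp, RingHom.comp_apply, ← map_expand]
  have := MvPowerSeries.map_frobenius_expand (p := p) (f := map π f) hp
  have h2 : PowerSeries.map (frobenius _ p) (expand p hp (PowerSeries.map π f)) =
    (PowerSeries.map π f) ^ p := this
  rw [h2, sub_self, map_zero]

/-- The logarithmic derivative of a unit of `R⟦X⟧`. -/
def dlog {R : Type*} [CommRing R] (u : R⟦X⟧ˣ) : R⟦X⟧ := ((u⁻¹ : R⟦X⟧ˣ) : R⟦X⟧) * d⁄dX R (u : R⟦X⟧)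

/-! ### Logarithmic derivatives and Dwork's congruences -/

section dlog
variable {R : Type*} [CommRing R]

theorem mul_dlog (u : R⟦X⟧ˣ) : (u : R⟦X⟧) * dlog u = d⁄dX R (u : R⟦X⟧) := by
  rw [dlog, ← mul_assoc, Units.mul_inv, one_mul]

theorem eq_dlog (u : R⟦X⟧ˣ) {f : R⟦X⟧} (h : (u : R⟦X⟧) * f = d⁄dX R (u : R⟦X⟧)) : f = dlog u := by
  rw [dlog, ← h, ← mul_assoc, Units.inv_mul, one_mul]

theorem dlog_mul (u v : R⟦X⟧ˣ) : dlog (u * v) = dlog u + dlog v := by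
  symm
  apply eq_dlog
  rw [Units.val_mul, Derivation.leibniz, ← mul_dlog u, ← mul_dlog v]
  simp only [smul_eq_mul]
  ring

theorem dlog_one : dlog (1 : R⟦X⟧ˣ) = 0 := by simp [dlog]

theorem dlog_inv (u : R⟦X⟧ˣ) : dlog u⁻¹ = -dlog u := by
  have := dlog_mul u u⁻¹
  rw [mul_inv_cancel, dlog_one] at this
  linear_combination -this

theorem dlog_pow (u : R⟦X⟧ˣ) (n : ℕ) : dlog (u ^ n) = n * dlog u := by
  induction n with
  | zero => simp [dlog_one]
  | succ n ih => rw [pow_succ, dlog_mul, ih]; push_cast; ring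

theorem dlog_expandMap {p : ℕ} (hp : p ≠ 0) (F : R →+* R) (u : R⟦X⟧ˣ) :
    dlog (Units.map (expandMap p hp F : R⟦X⟧ →* R⟦X⟧) u) =
      (p : R⟦X⟧) * X ^ (p - 1) * expandMap p hp F (dlog u) := by
  symm
  apply eq_dlog
  rw [Units.coe_map, MonoidHom.coe_coe, expandMap_apply (f := (u : R⟦X⟧)), derivative_expand, derivative_map,
    ← mul_dlog u, map_mul, map_mul, ← expandMap_apply, ← expandMap_apply]
  ring

/-- Since v ≡ 1 mod p, v^(p^s) = 1 + p^(s+1) w. Differentiating and cancelling p^s gives dlog v ≡ p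
w' mod p^(s+1), and the n-th coefficient of w' has the factor n + 1. -/
theorem pow_dvd_coeff_dlog {p : ℕ} (hreg : (p : R) ∈ nonZeroDivisors R) (v : R⟦X⟧ˣ)
    (hv : (p : R⟦X⟧) ∣ (v : R⟦X⟧) - 1) {s n : ℕ} (hn : p ^ s ∣ n + 1) :
    (p : R) ^ (s + 1) ∣ coeff n (dlog v) := by
  have h := dvd_sub_pow_of_dvd_sub hv s
  rw [one_pow] at h
  obtain ⟨w, hw⟩ := h
  have h1 : (v : R⟦X⟧) ^ p ^ s = 1 + (p : R⟦X⟧) ^ (s + 1) * w := by linear_combination hw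
  have hD : d⁄dX R ((v : R⟦X⟧) ^ p ^ s) = (p : R⟦X⟧) ^ (s + 1) * d⁄dX R w := by
    rw [h1, ← Nat.cast_pow, ← nsmul_eq_mul, map_add, map_nsmul, nsmul_eq_mul, derivative_one,
      zero_add]
  have h2 := mul_dlog (v ^ p ^ s)
  rw [dlog_pow, Units.val_pow_eq_pow_val, hD, h1] at h2
  push_cast at h2
  have h3 : (1 + (p : R⟦X⟧) ^ (s + 1) * w) * dlog v = p * d⁄dX R w := by
    have hr := pow_mem (natCast_mem_nonZeroDivisors hreg) s
    rw [← mul_cancel_left_mem_nonZeroDivisors hr]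
    linear_combination h2
  have h4 : dlog v = C (p : R) * d⁄dX R w - C ((p : R) ^ (s + 1)) * (w * dlog v) := by
    simp only [map_natCast, map_pow]
    linear_combination h3
  rw [h4, map_sub, coeff_C_mul, coeff_C_mul, coeff_derivative]
  apply dvd_sub _ (dvd_mul_right _ _)
  rw [pow_succ']
  apply mul_dvd_mul_left
  apply Dvd.dvd.mul_left
  have := Nat.cast_dvd_cast (α := R) hn
  push_cast at this
  exact this

/-- Dwork's congruence for the coefficients of a logarithmic derivative. -/
theorem pow_dvd_coeff_dlog_sub {p : ℕ} [Fact p.Prime] (hreg : (p : R) ∈ nonZeroDivisors R)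
    {F : R →+* R} (hF : IsFrobeniusLift p F) (u : R⟦X⟧ˣ) {s n : ℕ} (hn : p ^ s ∣ p * (n + 1)) :
    (p : R) ^ s ∣ coeff (p * (n + 1) - 1) (dlog u) - F (coeff n (dlog u)) := by
  have hp0 : p ≠ 0 := (Fact.out : p.Prime).ne_zero
  have hidx : p * (n + 1) - 1 = p * n + (p - 1) := by
    rw [mul_add, mul_one, Nat.add_sub_assoc (Nat.one_le_iff_ne_zero.2 hp0)]
  -- The Frobenius lift φ makes v = φ(u)/u^p congruent to 1 mod p. Its logarithmic derivative is
  -- p(X^(p-1) φ(dlog u) - dlog u), so cancelling this p reduces the divisibility by p^(s+1) to p^s.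
  let v := Units.map (expandMap p hp0 F : R⟦X⟧ →* R⟦X⟧) u * (u ^ p)⁻¹
  have hv : (p : R⟦X⟧) ∣ (v : R⟦X⟧) - 1 := by
    obtain ⟨g, hg⟩ := hF.expandMap hp0 (u : R⟦X⟧)
    refine ⟨g * ((u ^ p)⁻¹ : R⟦X⟧ˣ), ?_⟩
    have h1 := Units.mul_inv (u ^ p)
    rw [Units.val_pow_eq_pow_val] at h1
    simp only [v, Units.val_mul, Units.coe_map, MonoidHom.coe_coe]
    linear_combination ((u ^ p)⁻¹ : R⟦X⟧ˣ) * hg + h1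
  have h := pow_dvd_coeff_dlog hreg v hv (s := s) (n := p * n + (p - 1)) (by
    rwa [← hidx, Nat.sub_add_cancel (Nat.mul_pos (Nat.pos_of_ne_zero hp0) n.succ_pos)])
  have hd : dlog v = C (p : R) * (X ^ (p - 1) * expandMap p hp0 F (dlog u) - dlog u) := by
    rw [dlog_mul, dlog_inv, dlog_pow, dlog_expandMap, map_natCast]
    ring
  rw [hd, coeff_C_mul, map_sub, coeff_X_pow_mul, expandMap_apply, coeff_expand_mul, coeff_map,
    pow_succ', (isLeftRegular_iff_mem_nonZeroDivisorsLeft.mpr hreg.1).dvd_cancel_left] at h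
  rwa [hidx, ← dvd_neg, neg_sub]

end dlog

theorem PadicInt.isUnit_natCast_of_lt {p : ℕ} [Fact p.Prime] {n : ℕ} (h0 : n ≠ 0) (h : n < p) :
    IsUnit (n : ℤ_[p]) := by
  rw [PadicInt.isUnit_iff, PadicInt.norm_natCast_eq_one_iff]
  exact Nat.coprime_of_lt_prime h0 h Fact.out

/-! ### The trisected sine and cosine -/

section series
variable {A : Type*} [CommRing A]

theorem constantCoeff_eq_of_sub_mem_span_X {f g : A⟦X⟧} (h : f - g ∈ Ideal.span {(X : A⟦X⟧)}) :
    constantCoeff f = constantCoeff g := by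
  rwa [Ideal.mem_span_singleton, X_dvd_iff, map_sub, sub_eq_zero] at h

/-- `sin (arcsin t / 3)` as a power series. -/
theorem exists_trisected_sine (h2 : IsUnit (2 : A)) (h3 : IsUnit (3 : A)) :
    ∃ s : A⟦X⟧, 3 * s - 4 * s ^ 3 = X ∧ constantCoeff s = 0 := by
  obtain ⟨a, ha⟩ := h2.exists_right_inv
  -- The equation for y = 2s is monic: y³ - 3y + 2X = 0. Modulo X it has the root 0, where the
  -- derivative -3 is a unit.
  let P : Polynomial A⟦X⟧ := Polynomial.X ^ 3 + (Polynomial.C (-3) * Polynomial.X + Polynomial.C (2 * X))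
  have hP : P.Monic := by
    apply Polynomial.monic_X_pow_add
    compute_degree!
  obtain ⟨y, hy, hy0⟩ := HenselianRing.is_henselian (I := Ideal.span {(X : A⟦X⟧)}) P hP 0
    (by simp [P, Ideal.mem_span_singleton]) (by
      apply IsUnit.map
      simp only [P, Polynomial.derivative_add, Polynomial.derivative_mul, Polynomial.derivative_C,
        Polynomial.derivative_X, Polynomial.derivative_X_pow]
      simpa [isUnit_iff_constantCoeff, map_ofNat (constantCoeff (R := A))] using h3)
  have hy' : y ^ 3 - 3 * y + 2 * X = 0 := by
    have : P.eval y = 0 := hy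
    simp only [P, Polynomial.eval_add, Polynomial.eval_mul, Polynomial.eval_C, Polynomial.eval_pow,
      Polynomial.eval_X] at this
    linear_combination this
  have ha' : (2 : A⟦X⟧) * C a = 1 := by
    rw [← map_ofNat (C (R := A)), ← map_mul, ha, map_one]
  refine ⟨C a * y, ?_, ?_⟩
  · linear_combination -C a * hy' + (X : A⟦X⟧) * ha'
      - C a * y ^ 3 * (2 * C a + 1) * ha'
  · have := constantCoeff_eq_of_sub_mem_span_X hy0
    simp [this]

theorem exists_sqrt_one_sub_sq (h2 : IsUnit (2 : A)) {s : A⟦X⟧} (hs : constantCoeff s = 0) :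
    ∃ c : A⟦X⟧, c ^ 2 = 1 - s ^ 2 ∧ constantCoeff c = 1 := by
  let P : Polynomial A⟦X⟧ := Polynomial.X ^ 2 + Polynomial.C (s ^ 2 - 1)
  have hP : P.Monic := by
    apply Polynomial.monic_X_pow_add
    compute_degree!
  obtain ⟨y, hy, hy0⟩ := HenselianRing.is_henselian (I := Ideal.span {(X : A⟦X⟧)}) P hP 1
    (by simp [P, Ideal.mem_span_singleton, X_dvd_iff, hs]) (by
      apply IsUnit.map
      simp only [P, Polynomial.derivative_add, Polynomial.derivative_C, Polynomial.derivative_X_pow]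
      simpa [isUnit_iff_constantCoeff, map_ofNat (constantCoeff (R := A))] using h2)
  refine ⟨y, ?_, ?_⟩
  · have : P.eval y = 0 := hy
    simp only [P, Polynomial.eval_add, Polynomial.eval_C, Polynomial.eval_pow,
      Polynomial.eval_X] at this
    linear_combination this
  · simpa using constantCoeff_eq_of_sub_mem_span_X hy0

end series

/-! ### The differential system and uniqueness of its solutions -/

section system
variable {K : Type*} [Field K] [CharZero K]

/-- The first order differential system satisfied by both columns of `𝒴(t)`. -/
def IsSolution {A : Type*} [CommRing A] (f g : A⟦X⟧) : Prop :=
  3 * (1 - X ^ 2) * d⁄dX A f = 2 * X * f - g ∧ 3 * (1 - X ^ 2) * d⁄dX A g = -2 * f + X * g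

theorem IsSolution.map {A B : Type*} [CommRing A] [CommRing B] (F : A →+* B) {f g : A⟦X⟧}
    (h : IsSolution f g) : IsSolution (PowerSeries.map F f) (PowerSeries.map F g) := by
  constructor
  · simpa [derivative_map, map_ofNat (PowerSeries.map F)] using congrArg (PowerSeries.map F) h.1
  · simpa [derivative_map, map_ofNat (PowerSeries.map F)] using congrArg (PowerSeries.map F) h.2

/-- The coefficients of index n + 2 are determined by those of indices n and n + 1, the leading
factor 3(n + 2) being nonzero. Hence the induction carries two consecutive indices. -/
theorem IsSolution.eq_zero {f g : K⟦X⟧} (h : IsSolution f g) (hf : constantCoeff f = 0)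
    (hg : constantCoeff g = 0) : f = 0 ∧ g = 0 := by
  have key : ∀ n, (coeff n f = 0 ∧ coeff n g = 0) ∧ coeff (n + 1) f = 0 ∧ coeff (n + 1) g = 0 := by
    intro n
    induction n with
    | zero =>
      have h1 := congrArg constantCoeff h.1
      have h2 := congrArg constantCoeff h.2
      simp only [map_mul, map_sub, map_add, map_neg, map_pow, constantCoeff_X, hf, hg, map_one,
        map_ofNat (constantCoeff (R := K))] at h1 h2
      rw [← coeff_zero_eq_constantCoeff_apply, coeff_derivative] at h1 h2
      simp at h1 h2
      simp [hf, hg, h1, h2]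
    | succ n ih =>
      refine ⟨ih.2, ?_⟩
      have h1 := congrArg (coeff (n + 1)) h.1
      have h2 := congrArg (coeff (n + 1)) h.2
      have e : ∀ u : K⟦X⟧, coeff (n + 1) (X ^ 2 * d⁄dX K u) = coeff n u * n := by
        intro u
        rw [pow_two, mul_assoc, coeff_succ_X_mul]
        cases n with
        | zero => simp
        | succ m => rw [coeff_succ_X_mul, coeff_derivative]; push_cast; ring
      have e1 : 3 * (1 - X ^ 2) * d⁄dX K f = C 3 * (d⁄dX K f - X ^ 2 * d⁄dX K f) := by
        simp only [map_ofNat]; ring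
      have e2 : 3 * (1 - X ^ 2) * d⁄dX K g = C 3 * (d⁄dX K g - X ^ 2 * d⁄dX K g) := by
        simp only [map_ofNat]; ring
      have e3 : 2 * X * f - g = C 2 * (X * f) - g := by
        simp only [map_ofNat]; ring
      have e4 : -2 * f + X * g = C (-2) * f + X * g := by
        simp only [map_neg, map_ofNat]
      rw [e1, e3, coeff_C_mul, map_sub, e, coeff_derivative, map_sub, coeff_C_mul, coeff_succ_X_mul,
        ih.1.1, ih.2.2] at h1
      rw [e2, e4, coeff_C_mul, map_sub, e, coeff_derivative, map_add, coeff_C_mul, coeff_succ_X_mul,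
        ih.1.2, ih.2.1] at h2
      have hn : ((n + 1 : ℕ) : K) + 1 ≠ 0 := by exact_mod_cast (Nat.succ_ne_zero (n + 1))
      simp at h1 h2
      push_cast at hn
      simpa [hn] using And.intro h1 h2
  exact ⟨ext fun n => (key n).1.1, ext fun n => (key n).1.2⟩

theorem IsSolution.unique {f g f' g' : K⟦X⟧} (h : IsSolution f g) (h' : IsSolution f' g')
    (hf : constantCoeff f = constantCoeff f') (hg : constantCoeff g = constantCoeff g') :
    f = f' ∧ g = g' := by
  have hd : IsSolution (f - f') (g - g') := by
    constructor
    · rw [map_sub]; linear_combination h.1 - h'.1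
    · rw [map_sub]; linear_combination h.2 - h'.2
  have := hd.eq_zero (by simp [hf]) (by simp [hg])
  exact ⟨sub_eq_zero.1 this.1, sub_eq_zero.1 this.2⟩

end system

/-! ### The hypergeometric matrix solves the system -/

theorem ordinaryHypergeometricCoefficient_zero (a b c : ℚ) :
    ordinaryHypergeometricCoefficient a b c 0 = 1 := by
  simp [ordinaryHypergeometricCoefficient]

theorem ordinaryHypergeometricCoefficient_succ (a b c : ℚ) (n : ℕ) (hc : ∀ k : ℕ, c + k ≠ 0) :
    ordinaryHypergeometricCoefficient a b c (n + 1) * ((c + n) * (n + 1)) =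
      ordinaryHypergeometricCoefficient a b c n * ((a + n) * (b + n)) := by
  have hP : ∀ m : ℕ, (ascPochhammer ℚ m).eval c ≠ 0 := by
    intro m
    induction m with
    | zero => simp
    | succ m ih => rw [ascPochhammer_succ_eval]; exact mul_ne_zero ih (hc m)
  have h1 := hP n
  have h2 := hc n
  have h3 : ((n.factorial : ℕ) : ℚ) ≠ 0 := by exact_mod_cast n.factorial_ne_zero
  have h4 : (n : ℚ) + 1 ≠ 0 := by positivity
  simp only [ordinaryHypergeometricCoefficient, ascPochhammer_succ_eval, Nat.factorial_succ]
  push_cast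
  field_simp

theorem add_natCast_ne_zero {c : ℚ} (hc : 0 < c) (k : ℕ) : c + k ≠ 0 := by positivity

/-- The contiguity relation between the two series in a column of `𝒴(t)`. -/
theorem ordinaryHypergeometricCoefficient_contiguous (a b : ℚ) (ha : a ≠ 0) (n : ℕ) :
    ordinaryHypergeometricCoefficient (a + 1) b (3 / 2) n * ((2 * n + 1) * a) =
      ordinaryHypergeometricCoefficient a b (1 / 2) n * (a + n) := by
  induction n with
  | zero => simp [ordinaryHypergeometricCoefficient_zero]
  | succ n ih =>
    have h1 := ordinaryHypergeometricCoefficient_succ (a + 1) b (3 / 2) n (add_natCast_ne_zero (by norm_num))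
    have h2 := ordinaryHypergeometricCoefficient_succ a b (1 / 2) n (add_natCast_ne_zero (by norm_num))
    generalize ordinaryHypergeometricCoefficient (a + 1) b (3 / 2) (n + 1) = x' at *
    generalize ordinaryHypergeometricCoefficient a b (1 / 2) (n + 1) = y' at *
    generalize ordinaryHypergeometricCoefficient (a + 1) b (3 / 2) n = x at *
    generalize ordinaryHypergeometricCoefficient a b (1 / 2) n = y at *
    have h3 : (n : ℚ) + 1 ≠ 0 := by positivity
    have h4 : (1 / 2 + n : ℚ) ≠ 0 := by positivity
    have h5 : (3 / 2 + n : ℚ) ≠ 0 := by positivity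
    have h6 : (2 * n + 1 : ℚ) ≠ 0 := by positivity
    have e1 : x' = x * ((a + 1 + n) * (b + n)) / ((3 / 2 + n) * (n + 1)) := by
      rw [eq_div_iff (by positivity), h1]
    have e2 : y' = y * ((a + n) * (b + n)) / ((1 / 2 + n) * (n + 1)) := by
      rw [eq_div_iff (by positivity), h2]
    have e3 : x = y * (a + n) / ((2 * n + 1) * a) := by
      rw [eq_div_iff (by positivity), ih]
    rw [e1, e2, e3]
    push_cast
    field_simp
    ring

theorem coeff_gaussSeries (a b c : ℚ) (n : ℕ) :
    coeff n (gaussSeries a b c) = ordinaryHypergeometricCoefficient a b c n := coeff_mk _ _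

theorem derivative_gaussSeriesSq (a b c : ℚ) :
    d⁄dX ℚ (gaussSeriesSq a b c) = 2 * X * expand 2 two_ne_zero (d⁄dX ℚ (gaussSeries a b c)) := by
  rw [gaussSeriesSq, derivative_expand]
  norm_num

theorem coeff_X_mul_derivative {R : Type*} [CommRing R] (f : R⟦X⟧) (n : ℕ) :
    coeff n (X * d⁄dX R f) = n * coeff n f := by
  cases n with
  | zero => simp
  | succ n => rw [coeff_succ_X_mul, coeff_derivative]; push_cast; ring

/-- The columns of 𝒴 are the cases a = 1/3 and a = 1/6 of the pair F(a, 1-a; 1/2), F(a+1, 1-a; 3/2).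
This relation and `gaussSeries_odd` are the two equations of the system in the variable z = t². -/
theorem gaussSeries_even (a : ℚ) (ha : a ≠ 0) :
    (1 - X) * d⁄dX ℚ (gaussSeries a (1 - a) (1 / 2)) =
      C a * gaussSeries a (1 - a) (1 / 2) +
        C (a * (1 - 2 * a)) * gaussSeries (a + 1) (1 - a) (3 / 2) := by
  rw [sub_mul, one_mul]
  ext n
  rw [map_sub, coeff_X_mul_derivative, map_add, coeff_C_mul, coeff_C_mul, coeff_derivative]
  simp only [coeff_gaussSeries]
  have h1 := ordinaryHypergeometricCoefficient_contiguous a (1 - a) ha n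
  have h2 := ordinaryHypergeometricCoefficient_succ a (1 - a) (1 / 2) n
    (add_natCast_ne_zero (by norm_num))
  have h6 : (2 * n + 1 : ℚ) ≠ 0 := by positivity
  rw [← mul_left_inj' h6]
  linear_combination -(1 - 2 * a) * h1 + 2 * h2

theorem gaussSeries_odd (a : ℚ) (ha : a ≠ 0) :
    (1 - X) * (gaussSeries (a + 1) (1 - a) (3 / 2) +
        C 2 * (X * d⁄dX ℚ (gaussSeries (a + 1) (1 - a) (3 / 2)))) =
      gaussSeries a (1 - a) (1 / 2) +
        X * (C (1 - 2 * a) * gaussSeries (a + 1) (1 - a) (3 / 2)) := by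
  rw [sub_mul, one_mul]
  ext n
  cases n with
  | zero =>
    simp [gaussSeries, ordinaryHypergeometricCoefficient_zero]
  | succ n =>
    rw [map_sub, coeff_succ_X_mul, map_add, map_add, map_add, coeff_succ_X_mul,
      coeff_C_mul, coeff_C_mul, coeff_C_mul, coeff_X_mul_derivative, coeff_X_mul_derivative]
    simp only [coeff_gaussSeries]
    have h1 := ordinaryHypergeometricCoefficient_contiguous a (1 - a) ha n
    have h3 := ordinaryHypergeometricCoefficient_contiguous a (1 - a) ha (n + 1)
    have h2 := ordinaryHypergeometricCoefficient_succ a (1 - a) (1 / 2) n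
      (add_natCast_ne_zero (by norm_num))
    have h6 : a * (2 * n + 1 : ℚ) ≠ 0 := mul_ne_zero ha (by positivity)
    push_cast at h3 ⊢
    rw [← mul_left_inj' h6]
    linear_combination (2 * n + 1) * h3 + 2 * h2 - 2 * (n + 1 - a) * h1

theorem gaussSeries_swap (a b c : ℚ) : gaussSeries a b c = gaussSeries b a c := by
  ext n
  simp only [coeff_gaussSeries, ordinaryHypergeometricCoefficient]
  ring

theorem derivative_X_mul_gaussSeriesSq (k a b c : ℚ) :
    d⁄dX ℚ (C k * X * gaussSeriesSq a b c) =
      C k * expand 2 two_ne_zero (gaussSeries a b c + C 2 * (X * d⁄dX ℚ (gaussSeries a b c))) := by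
  rw [Derivation.leibniz, Derivation.leibniz, derivative_gaussSeriesSq, map_add, map_mul, map_mul,
    expand_C, expand_X, derivative_C, derivative_X, gaussSeriesSq]
  simp only [smul_eq_mul, map_ofNat]
  ring

theorem isSolution_hyperMatrix_left : IsSolution (hyperMatrix 0 0) (hyperMatrix 1 0) := by
  have h1 := congrArg (expand 2 two_ne_zero) (gaussSeries_even (1 / 3) (by norm_num))
  have h2 := congrArg (expand 2 two_ne_zero) (gaussSeries_odd (1 / 3) (by norm_num))
  rw [show (1 / 3 + 1 : ℚ) = 4 / 3 by norm_num, show (1 - 1 / 3 : ℚ) = 2 / 3 by norm_num,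
    gaussSeries_swap (4 / 3)] at h1 h2
  rw [show (1 / 3 * (1 - 2 * (1 / 3)) : ℚ) = 1 / 3 * (1 / 3) by norm_num] at h1
  rw [show (1 - 2 * (1 / 3) : ℚ) = 1 / 3 by norm_num] at h2
  have hx : (3 : ℚ⟦X⟧) * C (1 / 3 : ℚ) = 1 := by
    rw [← map_ofNat (C (R := ℚ)), ← map_mul]; norm_num
  have hk : C (-(2 / 3) : ℚ) = -2 * C (1 / 3 : ℚ) := by
    rw [← map_ofNat (C (R := ℚ)), ← map_neg, ← map_mul]; norm_num
  simp only [map_mul, map_add, map_sub, map_one, expand_X, expand_C, map_ofNat] at h1 h2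
  simp only [hyperMatrix, Matrix.of_apply, Matrix.cons_val_zero, Matrix.cons_val_one,
    Matrix.cons_val', Matrix.cons_val_fin_one]
  constructor
  · rw [derivative_gaussSeriesSq, hk]
    simp only [gaussSeriesSq]
    generalize C (1 / 3 : ℚ) = x at *
    generalize expand 2 two_ne_zero (gaussSeries (1 / 3) (2 / 3) (1 / 2)) = f at *
    generalize expand 2 two_ne_zero (gaussSeries (2 / 3) (4 / 3) (3 / 2)) = g at *
    linear_combination 6 * X * h1 + (2 * X * f + 2 * X * x * g) * hx
  · rw [derivative_X_mul_gaussSeriesSq, hk]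
    simp only [gaussSeriesSq, map_add, map_mul, expand_X, map_ofNat]
    generalize C (1 / 3 : ℚ) = x at *
    generalize expand 2 two_ne_zero (gaussSeries (1 / 3) (2 / 3) (1 / 2)) = f at *
    generalize expand 2 two_ne_zero (gaussSeries (2 / 3) (4 / 3) (3 / 2)) = g at *
    linear_combination -6 * x * h2 - (2 * f + 2 * X ^ 2 * x * g) * hx

theorem isSolution_hyperMatrix_right : IsSolution (hyperMatrix 0 1) (hyperMatrix 1 1) := by
  have h1 := congrArg (expand 2 two_ne_zero) (gaussSeries_even (1 / 6) (by norm_num))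
  have h2 := congrArg (expand 2 two_ne_zero) (gaussSeries_odd (1 / 6) (by norm_num))
  rw [show (1 / 6 + 1 : ℚ) = 7 / 6 by norm_num, show (1 - 1 / 6 : ℚ) = 5 / 6 by norm_num] at h1 h2
  rw [show (1 / 6 * (1 - 2 * (1 / 6)) : ℚ) = 1 / 3 * (1 / 3) by norm_num] at h1
  rw [show (1 - 2 * (1 / 6) : ℚ) = 2 * (1 / 3) by norm_num] at h2
  have hx : (3 : ℚ⟦X⟧) * C (1 / 3 : ℚ) = 1 := by
    rw [← map_ofNat (C (R := ℚ)), ← map_mul]; norm_num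
  have hy : (6 : ℚ⟦X⟧) * C (1 / 6 : ℚ) = 1 := by
    rw [← map_ofNat (C (R := ℚ)), ← map_mul]; norm_num
  simp only [map_mul, map_add, map_sub, map_one, expand_X, expand_C, map_ofNat] at h1 h2
  simp only [hyperMatrix, Matrix.of_apply, Matrix.cons_val_zero, Matrix.cons_val_one,
    Matrix.cons_val', Matrix.cons_val_fin_one]
  constructor
  · rw [derivative_X_mul_gaussSeriesSq, map_neg]
    simp only [gaussSeriesSq, map_add, map_mul, expand_X, map_ofNat]
    generalize C (1 / 3 : ℚ) = x at *
    generalize expand 2 two_ne_zero (gaussSeries (1 / 6) (5 / 6) (1 / 2)) = f at *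
    generalize expand 2 two_ne_zero (gaussSeries (7 / 6) (5 / 6) (3 / 2)) = g at *
    linear_combination -3 * x * h2 - (f + 2 * X ^ 2 * x * g) * hx
  · rw [derivative_gaussSeriesSq, map_neg]
    simp only [gaussSeriesSq]
    generalize C (1 / 3 : ℚ) = x at *
    generalize C (1 / 6 : ℚ) = y at *
    generalize expand 2 two_ne_zero (gaussSeries (1 / 6) (5 / 6) (1 / 2)) = f at *
    generalize expand 2 two_ne_zero (gaussSeries (7 / 6) (5 / 6) (3 / 2)) = g at *
    linear_combination 6 * X * h1 + X * f * hy + 2 * X * x * g * hx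

theorem constantCoeff_hyperMatrix (i j : Fin 2) :
    constantCoeff (hyperMatrix i j) = if i = j then 1 else 0 := by
  fin_cases i <;> fin_cases j <;>
  simp [hyperMatrix, gaussSeriesSq, gaussSeries, ordinaryHypergeometricCoefficient_zero]

/-! ### The closed form solves the system -/

/-- The matrix `𝒴` in terms of `s = sin (x / 3)`, `k = 1 / (1 - 4 s ^ 2)` and
`d = 1 / cos (x / 3)`. -/
def trisectionMatrix {B : Type*} [CommRing B] (s k d : B) : Matrix (Fin 2) (Fin 2) B :=
  !![k, -(s * k * d); -(2 * s * k), (1 - 2 * s ^ 2) * k * d]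

/-- The inverse of `trisectionMatrix s (1 - 4 * s ^ 2)⁻¹ c⁻¹`. -/
def trisectionInverse {B : Type*} [CommRing B] (s c : B) : Matrix (Fin 2) (Fin 2) B :=
  !![1 - 2 * s ^ 2, s; 2 * s * c, c]

theorem trisectionInverse_mul {B : Type*} [CommRing B] {s c k d : B}
    (hk : (1 - 4 * s ^ 2) * k = 1) (hd : c * d = 1) :
    trisectionInverse s c * trisectionMatrix s k d = 1 := by
  ext i j
  fin_cases i <;> fin_cases j <;>
  simp [trisectionInverse, trisectionMatrix, Matrix.mul_apply, Fin.sum_univ_two] <;> grind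

section derivatives
variable {A : Type*} [CommRing A] {S c k d : A⟦X⟧}

theorem derivative_trisected_sine (hS : 3 * S - 4 * S ^ 3 = X) (hk : (1 - 4 * S ^ 2) * k = 1) :
    3 * d⁄dX A S = k := by
  have h := congrArg (d⁄dX A) hS
  have e : 3 * S - 4 * S ^ 3 = (3 : ℕ) • S - (4 : ℕ) • S ^ 3 := by simp
  rw [e, map_sub, map_nsmul, map_nsmul, derivative_pow, derivative_X] at h
  simp only [nsmul_eq_mul, Nat.cast_ofNat] at h
  norm_num at h
  linear_combination k * h - 3 * d⁄dX A S * hk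

theorem derivative_trisected_cosine (h2 : IsUnit (2 : A)) (hc : c ^ 2 = 1 - S ^ 2)
    (hd : c * d = 1) : d⁄dX A c = -(S * d⁄dX A S * d) := by
  have h := congrArg (d⁄dX A) hc
  rw [map_sub, derivative_pow, derivative_pow, derivative_one] at h
  norm_num at h
  have h2' : IsUnit (2 : A⟦X⟧) := by simpa only [map_ofNat] using h2.map (C (R := A))
  rw [← h2'.mul_right_inj]
  linear_combination d * h - 2 * d⁄dX A c * hd

theorem derivative_of_mul_eq_one {u v : A⟦X⟧} (h : u * v = 1) :
    d⁄dX A v = -(v ^ 2 * d⁄dX A u) := by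
  have h' := congrArg (d⁄dX A) h
  rw [Derivation.leibniz, derivative_one] at h'
  simp only [smul_eq_mul] at h'
  linear_combination v * h' - d⁄dX A v * h

theorem derivative_one_sub_four_sq (S : A⟦X⟧) : d⁄dX A (1 - 4 * S ^ 2) = -(8 * S * d⁄dX A S) := by
  have e : 1 - 4 * S ^ 2 = 1 - (4 : ℕ) • S ^ 2 := by simp
  rw [e, map_sub, map_nsmul, derivative_pow, derivative_one]
  simp only [nsmul_eq_mul]
  push_cast
  ring

/-- All derivatives are multiples of S', and 3S' = k. With X = 3S - 4S³, the triple angle formula 1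
- X² = c²(1 - 4S²)² cancels the denominators. -/
theorem isSolution_trisectionMatrix (h2 : IsUnit (2 : A)) (hS : 3 * S - 4 * S ^ 3 = X)
    (hc : c ^ 2 = 1 - S ^ 2) (hk : (1 - 4 * S ^ 2) * k = 1) (hd : c * d = 1) (j : Fin 2) :
    IsSolution (trisectionMatrix S k d 0 j) (trisectionMatrix S k d 1 j) := by
  have e1 := derivative_trisected_sine hS hk
  have e2 := derivative_trisected_cosine h2 hc hd
  have e3 := derivative_of_mul_eq_one hd
  have e4 := derivative_of_mul_eq_one hk
  rw [derivative_one_sub_four_sq] at e4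
  have e5 : d⁄dX A (2 * S * k) = 2 * (S * d⁄dX A k + k * d⁄dX A S) := by
    have : 2 * S * k = (2 : ℕ) • (S * k) := by simp [mul_assoc]
    rw [this, map_nsmul, Derivation.leibniz]
    simp only [nsmul_eq_mul, smul_eq_mul, Nat.cast_ofNat]
  have e6 : d⁄dX A (1 - 2 * S ^ 2) = -(4 * S * d⁄dX A S) := by
    have : 1 - 2 * S ^ 2 = 1 - (2 : ℕ) • S ^ 2 := by simp
    rw [this, map_sub, map_nsmul, derivative_pow, derivative_one]
    simp only [nsmul_eq_mul]
    push_cast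
    ring
  fin_cases j <;> simp only [trisectionMatrix, Matrix.of_apply, Matrix.cons_val_zero,
    Matrix.cons_val_one, Matrix.cons_val', Matrix.cons_val_fin_one, Fin.zero_eta, Fin.mk_one,
    IsSolution, map_neg, e5, Derivation.leibniz, smul_eq_mul, e6] <;>
  try simp only [e3, e2, e4]
  all_goals
    rw [← hS]
    generalize d⁄dX A S = y at *
    clear e2 e3 e4 e5 e6 hS
    constructor
    all_goals grind

end derivatives

/-! ### Kernel entries as logarithmic derivatives -/

section kernel
variable {R : Type*} [CommRing R] {S C s c K E V : R⟦X⟧}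

/-- Here S = s(σ) and X = σ, while s = s(τ) is constant in σ. Since σ - τ = (S - s)u and the right
side of `hV` is 2K(S - s)(2S + s), V equals 2K(2S + s)/u, a multiple of u'/u because 3S' = K. -/
theorem kernel_zero_zero (hW : (X - (3 * s - 4 * s ^ 3) : R⟦X⟧) ∈ nonZeroDivisors R⟦X⟧)
    (hS : 3 * S - 4 * S ^ 3 = X) (hs : d⁄dX R s = 0) (hK : (1 - 4 * S ^ 2) * K = 1)
    (hV : (X - (3 * s - 4 * s ^ 3)) * V = (1 - 2 * s ^ 2) * K - 2 * s * S * K - 1) (u : R⟦X⟧ˣ)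
    (hu : (u : R⟦X⟧) = 3 - 4 * (S ^ 2 + S * s + s ^ 2)) : 2 * V = -3 * dlog u := by
  have e1 := derivative_trisected_sine hS hK
  have e2 := mul_dlog u
  have e3 : d⁄dX R (u : R⟦X⟧) = -4 * (2 * S + s) * d⁄dX R S := by
    have : 3 - 4 * (S ^ 2 + S * s + s ^ 2) =
      (3 : ℕ) • (1 : R⟦X⟧) - (4 : ℕ) • (S ^ 2 + S * s + s ^ 2) := by
      simp only [nsmul_eq_mul, Nat.cast_ofNat, mul_one]
    rw [hu, this, map_sub, map_nsmul, map_nsmul, map_add, map_add, Derivation.leibniz,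
      derivative_pow, derivative_pow, hs, derivative_one]
    simp only [nsmul_eq_mul, smul_eq_mul]
    push_cast
    ring
  rw [e3, hu] at e2
  rw [← mul_cancel_left_mem_nonZeroDivisors hW]
  rw [← hS] at *
  generalize d⁄dX R S = y at *
  generalize dlog u = l at *
  linear_combination 2 * hV + 3 * (S - s) * e2 - 4 * (S - s) * (2 * S + s) * e1 + 2 * hK

/-- Over √3 the quadratic factor of σ - τ splits: 3 - 4(S² + Ss + s²) = -uv, by C² = 1 - S². The two
partial fractions give the difference of logarithmic derivatives. -/
theorem kernel_zero_one (h2 : IsUnit (2 : R))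
    (hW : (X - (3 * s - 4 * s ^ 3) : R⟦X⟧) ∈ nonZeroDivisors R⟦X⟧)
    (hS : 3 * S - 4 * S ^ 3 = X) (hs : d⁄dX R s = 0) (hC : C ^ 2 = 1 - S ^ 2)
    (hK : (1 - 4 * S ^ 2) * K = 1) (hE : C * E = 1) {r : R} (hr : r ^ 2 = 3)
    (hV : (X - (3 * s - 4 * s ^ 3)) * V =
      -((1 - 2 * s ^ 2) * (S * K * E)) + s * ((1 - 2 * S ^ 2) * K * E)) (u v : R⟦X⟧ˣ)
    (hu : (u : R⟦X⟧) = S + 2 * s + PowerSeries.C r * C)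
    (hv : (v : R⟦X⟧) = S + 2 * s - PowerSeries.C r * C) :
    2 * V = PowerSeries.C r * (dlog v - dlog u) := by
  have e1 := derivative_trisected_sine hS hK
  have e2 := derivative_trisected_cosine h2 hC hE
  have e3 := mul_dlog u
  have e4 := mul_dlog v
  have hr' : (PowerSeries.C r) ^ 2 = 3 := by rw [← map_pow, hr, map_ofNat]
  have hs2 : d⁄dX R (2 * s) = 0 := by
    rw [show 2 * s = (2 : ℕ) • s by simp, map_nsmul, hs, nsmul_zero]
  rw [hu, map_add, map_add, hs2, Derivation.leibniz, derivative_C, e2] at e3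
  rw [hv, map_sub, map_add, hs2, Derivation.leibniz, derivative_C, e2] at e4
  simp only [smul_eq_mul] at e3 e4
  rw [← mul_cancel_left_mem_nonZeroDivisors hW]
  rw [← hS] at *
  generalize d⁄dX R S = y at *
  generalize dlog u = l at *
  generalize dlog v = m at *
  generalize PowerSeries.C r = r at *
  have hW' : 3 * S - 4 * S ^ 3 - (3 * s - 4 * s ^ 3) =
    -(S - s) * ((S + 2 * s + r * C) * (S + 2 * s - r * C)) := by
    linear_combination (-(S - s) * C ^ 2) * hr' - 3 * (S - s) * hC
  -- Grouped so that v·dlog v and u·dlog u appear and can be replaced by derivatives.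
  have e5 : (3 * S - 4 * S ^ 3 - (3 * s - 4 * s ^ 3)) * (r * (m - l)) =
    -(S - s) * r * ((S + 2 * s + r * C) * ((S + 2 * s - r * C) * m) -
      (S + 2 * s - r * C) * ((S + 2 * s + r * C) * l)) := by
    rw [hW']; ring
  rw [e5, e3, e4]
  linear_combination 2 * hV + 2 * (S - s) * (C + S * E * (S + 2 * s)) * (y * hr' + e1) -
    2 * (S - s) * K * C * hE + 2 * (S - s) * K * E * hC

/-- The same quadratic factor also splits with c in place of C, by c² = 1 - s². -/
theorem kernel_one_zero
    (hW : (X - (3 * s - 4 * s ^ 3) : R⟦X⟧) ∈ nonZeroDivisors R⟦X⟧)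
    (hS : 3 * S - 4 * S ^ 3 = X) (hs : d⁄dX R s = 0) (hc' : d⁄dX R c = 0) (hc : c ^ 2 = 1 - s ^ 2)
    (hK : (1 - 4 * S ^ 2) * K = 1) {r : R} (hr : r ^ 2 = 3)
    (hV : (X - (3 * s - 4 * s ^ 3)) * V = 2 * s * c * K - c * (2 * S * K)) (u v : R⟦X⟧ˣ)
    (hu : (u : R⟦X⟧) = 2 * S + s + PowerSeries.C r * c)
    (hv : (v : R⟦X⟧) = 2 * S + s - PowerSeries.C r * c) :
    2 * V = PowerSeries.C r * (dlog v - dlog u) := by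
  have e1 := derivative_trisected_sine hS hK
  have e3 := mul_dlog u
  have e4 := mul_dlog v
  have hr' : (PowerSeries.C r) ^ 2 = 3 := by rw [← map_pow, hr, map_ofNat]
  have hs2 : d⁄dX R (2 * S) = 2 * d⁄dX R S := by
    rw [show 2 * S = (2 : ℕ) • S by simp, map_nsmul]; simp
  rw [hu, map_add, map_add, hs2, hs, Derivation.leibniz, derivative_C, hc'] at e3
  rw [hv, map_sub, map_add, hs2, hs, Derivation.leibniz, derivative_C, hc'] at e4
  simp only [smul_eq_mul] at e3 e4
  rw [← mul_cancel_left_mem_nonZeroDivisors hW]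
  rw [← hS] at *
  generalize d⁄dX R S = y at *
  generalize dlog u = l at *
  generalize dlog v = m at *
  generalize PowerSeries.C r = r at *
  have hW' : 3 * S - 4 * S ^ 3 - (3 * s - 4 * s ^ 3) =
    -(S - s) * ((2 * S + s + r * c) * (2 * S + s - r * c)) := by
    linear_combination (-(S - s) * c ^ 2) * hr' - 3 * (S - s) * hc
  have e5 : (3 * S - 4 * S ^ 3 - (3 * s - 4 * s ^ 3)) * (r * (m - l)) =
    -(S - s) * r * ((2 * S + s + r * c) * ((2 * S + s - r * c) * m) -
      (2 * S + s - r * c) * ((2 * S + s + r * c) * l)) := by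
    rw [hW']; ring
  rw [e5, e3, e4]
  linear_combination 2 * hV + 4 * (S - s) * c * (y * hr' + e1)

/-- If S = sin a, s = sin b and θ = a + b, then C*c - S*s = cos θ, and v w² = 1 + cos 3θ = 2
cos²(3θ/2), where cos(3θ/2) is a factor of σ - τ = sin 3a - sin 3b. -/
theorem kernel_one_one (h2 : IsUnit (2 : R)) (h3 : IsUnit (3 : R))
    (hW : (X - (3 * s - 4 * s ^ 3) : R⟦X⟧) ∈ nonZeroDivisors R⟦X⟧)
    (hS : 3 * S - 4 * S ^ 3 = X) (hs : d⁄dX R s = 0) (hc' : d⁄dX R c = 0)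
    (hC : C ^ 2 = 1 - S ^ 2) (hc : c ^ 2 = 1 - s ^ 2)
    (hK : (1 - 4 * S ^ 2) * K = 1) (hE : C * E = 1)
    (hV : (X - (3 * s - 4 * s ^ 3)) * V =
      -(2 * s * c * (S * K * E)) + c * ((1 - 2 * S ^ 2) * K * E) - 1) (u v w : R⟦X⟧ˣ)
    (hu : (u : R⟦X⟧) = 3 - 4 * (S ^ 2 + S * s + s ^ 2))
    (hv : (v : R⟦X⟧) = C * c - S * s + 1) (hw : (w : R⟦X⟧) = 2 * (C * c - S * s) - 1) :
    2 * V = -3 * dlog u - 2 * dlog v + 2 * dlog w := by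
  have e1 := derivative_trisected_sine hS hK
  have e2 := derivative_trisected_cosine h2 hC hE
  have e3 := mul_dlog u
  have e4 := mul_dlog v
  have e5 := mul_dlog w
  have d3 : d⁄dX R (u : R⟦X⟧) = -4 * (2 * S + s) * d⁄dX R S := by
    have : 3 - 4 * (S ^ 2 + S * s + s ^ 2) =
      (3 : ℕ) • (1 : R⟦X⟧) - (4 : ℕ) • (S ^ 2 + S * s + s ^ 2) := by
      simp only [nsmul_eq_mul, Nat.cast_ofNat, mul_one]
    rw [hu, this, map_sub, map_nsmul, map_nsmul, map_add, map_add, Derivation.leibniz,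
      derivative_pow, derivative_pow, hs, derivative_one]
    simp only [nsmul_eq_mul, smul_eq_mul]
    push_cast
    ring
  have d0 : d⁄dX R (C * c - S * s) = -((S * E * c + s) * d⁄dX R S) := by
    rw [map_sub, Derivation.leibniz, Derivation.leibniz, hc', hs, e2]
    simp only [smul_eq_mul]
    ring
  have d5 : d⁄dX R (w : R⟦X⟧) = 2 * d⁄dX R (C * c - S * s) := by
    have : 2 * (C * c - S * s) - 1 = (2 : ℕ) • (C * c - S * s) - 1 := by
      simp only [nsmul_eq_mul, Nat.cast_ofNat]
    rw [hw, this, map_sub, map_nsmul, derivative_one, nsmul_eq_mul, sub_zero]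
    push_cast
    ring
  rw [d3, hu] at e3
  rw [hv, map_add, derivative_one, d0] at e4
  rw [d5, d0, hw] at e5
  have h3' : IsUnit (3 : R⟦X⟧) := by simpa only [map_ofNat] using h3.map (PowerSeries.C (R := R))
  have hv' := v.isUnit
  have hw' := w.isUnit
  rw [hv] at hv'
  rw [hw] at hw'
  rw [← mul_cancel_left_mem_nonZeroDivisors hW, ← h3'.mul_right_inj, ← hv'.mul_right_inj,
    ← hw'.mul_right_inj]
  rw [← hS] at *
  clear hW h3' hv' hw' hv hw hu d0 d3 d5
  generalize d⁄dX R S = y at *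
  generalize dlog u = l at *
  generalize dlog v = m at *
  generalize dlog w = n at *
  generalize hZ : C * c - S * s = Z at *
  -- What remains after clearing the denominators u, v, w, K and E: a polynomial identity modulo the
  -- two Pythagorean relations.
  have hP : (2 * Z - 1) * (Z + 1) * (-2 * s * c * S + c * (1 - 2 * S ^ 2) - C * (1 - 4 * S ^ 2)) -
      2 * (S - s) * (2 * S + s) * C * (Z + 1) * (2 * Z - 1) +
      (S - s) * (3 - 4 * (S ^ 2 + S * s + s ^ 2)) * (S * c + s * C) = 0 := by
    rw [← hZ]
    clear * - hC hc
    grind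
  have hW : 3 * S - 4 * S ^ 3 - (3 * s - 4 * s ^ 3) =
    (S - s) * (3 - 4 * (S ^ 2 + S * s + s ^ 2)) := by ring
  rw [hW] at hV ⊢
  generalize 3 - 4 * (S ^ 2 + S * s + s ^ 2) = U at *
  linear_combination 6 * (2 * Z - 1) * (Z + 1) * hV + 9 * (S - s) * (Z + 1) * (2 * Z - 1) * e3 +
    6 * (2 * Z - 1) * (S - s) * U * e4 - 6 * (Z + 1) * (S - s) * U * e5 +
    (6 * (S - s) * U * (S * E * c + s) -
      12 * (2 * Z - 1) * (Z + 1) * (S - s) * (2 * S + s)) * e1 + 6 * K * E * hP +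
    6 * (2 * Z - 1) * (Z + 1) * ((1 - 4 * S ^ 2) * K * hE + hK) +
    (12 * K * (S - s) * (2 * S + s) * (2 * Z - 1) * (Z + 1) - 6 * K * (S - s) * U * s) * hE

end kernel

/-! ### Shifts and difference quotients in two variables -/

section differenceQuotient
variable {R : Type*} [CommRing R]

/-- The power series `∑ n, f (n + N) X ^ n`. -/
def shift (N : ℕ) (f : R⟦X⟧) : R⟦X⟧ := mk fun n => coeff (n + N) f

theorem map_shift {S : Type*} [CommRing S] (F : R →+* S) (N : ℕ) (f : R⟦X⟧) :
    PowerSeries.map F (shift N f) = shift N (PowerSeries.map F f) := by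
  ext n
  simp [shift]

/-- `(f(σ) - f(τ)) / (σ - τ)` as a power series in `σ` over power series in `τ`. -/
def differenceQuotient (f : R⟦X⟧) : R⟦X⟧⟦X⟧ := mk fun n => shift (n + 1) f

theorem X_sub_C_X_mul_differenceQuotient (f : R⟦X⟧) :
    (X - C (X : R⟦X⟧)) * differenceQuotient f = PowerSeries.map (C (R := R)) f - C f := by
  rw [sub_mul]
  ext n m
  rw [map_sub, coeff_C_mul, map_sub, map_sub, map_sub, coeff_map]
  cases n with
  | zero =>
    cases m with
    | zero => simp
    | succ m => simp [differenceQuotient, shift, coeff_succ_X_mul, coeff_C]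
  | succ n =>
    rw [coeff_succ_X_mul]
    cases m with
    | zero => simp [differenceQuotient, shift, coeff_C]
    | succ m =>
      simp [differenceQuotient, shift, coeff_succ_X_mul, add_comm, add_left_comm]

theorem X_sub_C_X_mem_nonZeroDivisors : X - C (X : R⟦X⟧) ∈ nonZeroDivisors R⟦X⟧⟦X⟧ := by
  rw [mem_nonZeroDivisors_iff_right]
  intro g hg
  have hX : ∀ f : R⟦X⟧, X * f = 0 → f = 0 := fun f hf => by
    ext n
    have := congrArg (coeff (n + 1)) hf
    rwa [coeff_succ_X_mul] at this
  rw [mul_comm, sub_mul] at hg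
  ext1 n
  induction n with
  | zero =>
    have := congrArg (coeff 0) hg
    rw [map_sub, coeff_C_mul] at this
    apply hX
    simpa using this
  | succ n ih =>
    have := congrArg (coeff (n + 1)) hg
    rw [map_sub, coeff_C_mul, coeff_succ_X_mul, ih] at this
    apply hX
    simpa using this

end differenceQuotient

/-! ### Twisted Dwork congruences -/

section DworkCongruence
variable {R : Type*} [CommRing R] {p : ℕ} {G : R →+* R} {e : ℤ}

/-- Dwork's congruences, twisted by `e`, for the coefficients of `g`. -/
def DworkCongr (p : ℕ) (G : R →+* R) (e : ℤ) (g : R⟦X⟧) : Prop :=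
  ∀ s n : ℕ, p ^ s ∣ p * (n + 1) →
    (p : R) ^ s ∣ coeff (p * (n + 1) - 1) g - e * G (coeff n g)

theorem DworkCongr.add {f g : R⟦X⟧} (hf : DworkCongr p G e f) (hg : DworkCongr p G e g) :
    DworkCongr p G e (f + g) := fun s n h => by
  have := dvd_add (hf s n h) (hg s n h)
  rw [map_add, map_add, map_add]
  convert this using 1
  ring

theorem DworkCongr.intCast_mul {f : R⟦X⟧} (hf : DworkCongr p G e f) (a : ℤ) :
    DworkCongr p G e (a * f) := fun s n h => by
  have := Dvd.dvd.mul_left (hf s n h) a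
  rw [← map_intCast (C (R := R)), coeff_C_mul, coeff_C_mul, map_mul, map_intCast]
  convert this using 1
  ring

/-- The twist enters here: e·G(r x) = e² r·G(x) = r·G(x), so multiplying by an eigenvector r of G
with eigenvalue e turns the untwisted congruence into the e-twisted one. -/
theorem DworkCongr.C_mul {f : R⟦X⟧} (hf : DworkCongr p G 1 f) {r : R} (he : e ^ 2 = 1)
    (hr : G r = e * r) : DworkCongr p G e (C r * f) := fun s n h => by
  have := Dvd.dvd.mul_left (hf s n h) r
  rw [coeff_C_mul, coeff_C_mul, map_mul, hr]
  convert this using 1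
  have he' : (e : R) ^ 2 = 1 := by exact_mod_cast congrArg (Int.cast (R := R)) he
  push_cast
  linear_combination (-r * G (coeff n f)) * he'

theorem DworkCongr.of_two_mul (h2 : IsUnit (2 : R)) {f : R⟦X⟧} (hf : DworkCongr p G e (2 * f)) :
    DworkCongr p G e f := fun s n h => by
  have := hf s n h
  rw [← map_ofNat (C (R := R)), coeff_C_mul, coeff_C_mul, map_mul, map_ofNat, mul_left_comm,
    ← mul_sub] at this
  exact h2.dvd_mul_left.1 this

theorem dworkCongr_dlog [Fact p.Prime] (hreg : (p : R) ∈ nonZeroDivisors R)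
    (hG : IsFrobeniusLift p G) (u : R⟦X⟧ˣ) : DworkCongr p G 1 (dlog u) := fun s n h => by
  simpa using pow_dvd_coeff_dlog_sub hreg hG u h

end DworkCongruence

/-! ### The kernel and its congruences -/

theorem map_trisectionMatrix {A B : Type*} [CommRing A] [CommRing B] (F : A →+* B) (s k d : A) :
    (trisectionMatrix s k d).map F = trisectionMatrix (F s) (F k) (F d) := by
  ext i j
  fin_cases i <;> fin_cases j <;> simp [trisectionMatrix, map_ofNat F]

theorem map_trisectionInverse {A B : Type*} [CommRing A] [CommRing B] (F : A →+* B) (s c : A) :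
    (trisectionInverse s c).map F = trisectionInverse (F s) (F c) := by
  ext i j
  fin_cases i <;> fin_cases j <;> simp [trisectionInverse, map_ofNat F]

/-- The generating series `∑ N, 𝒴⁻¹ (shift (N + 1) 𝒴) σ ^ N`. -/
def kernelMatrix {R : Type*} [CommRing R] (s c k d : R⟦X⟧) : Matrix (Fin 2) (Fin 2) R⟦X⟧⟦X⟧ :=
  (trisectionInverse s c).map C * (trisectionMatrix s k d).map differenceQuotient

theorem coeff_kernelMatrix {R : Type*} [CommRing R] (s c k d : R⟦X⟧) (n : ℕ) (i j : Fin 2) :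
    coeff n (kernelMatrix s c k d i j) =
      (trisectionInverse s c * (trisectionMatrix s k d).map (shift (n + 1))) i j := by
  simp [kernelMatrix, Matrix.mul_apply, coeff_C_mul, differenceQuotient]

theorem X_sub_C_X_mul_kernelMatrix {R : Type*} [CommRing R] {s c k d : R⟦X⟧}
    (hk : (1 - 4 * s ^ 2) * k = 1) (hd : c * d = 1) (i j : Fin 2) :
    (X - C (X : R⟦X⟧)) * kernelMatrix s c k d i j =
      ((trisectionInverse s c).map C *
        (trisectionMatrix s k d).map (PowerSeries.map (C (R := R))) - 1) i j := by
  have h : (trisectionInverse s c).map (C (R := R⟦X⟧)) * (trisectionMatrix s k d).map C = 1 := by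
    rw [← Matrix.map_mul, trisectionInverse_mul hk hd, Matrix.map_one _ (map_zero _) (map_one _)]
  rw [← h]
  simp only [kernelMatrix, Matrix.sub_apply, Matrix.mul_apply, Fin.sum_univ_two, Matrix.map_apply]
  rw [mul_add, mul_left_comm, X_sub_C_X_mul_differenceQuotient, mul_left_comm,
    X_sub_C_X_mul_differenceQuotient]
  ring

/-- The constant term of a power series in two variables. -/
theorem exists_augmentation (R : Type*) [CommRing R] :
    ∃ α : R⟦X⟧⟦X⟧ →+* R, (∀ f, IsUnit (α f) → IsUnit f) ∧
      (∀ f : R⟦X⟧, α (PowerSeries.map C f) = constantCoeff f) ∧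
      ∀ f : R⟦X⟧, α (C f) = constantCoeff f := by
  refine ⟨(constantCoeff (R := R)).comp (constantCoeff (R := R⟦X⟧)), fun f h => ?_, fun f => ?_,
    fun f => ?_⟩
  · rwa [isUnit_iff_constantCoeff, isUnit_iff_constantCoeff]
  · rw [RingHom.comp_apply, ← coeff_zero_eq_constantCoeff_apply (PowerSeries.map C f), coeff_map,
      constantCoeff_C, coeff_zero_eq_constantCoeff_apply]
  · rw [RingHom.comp_apply, constantCoeff_C]

/-- The Frobenius lift on the coefficient ring O⟦τ⟧ is F together with τ ↦ τ^p. Off the diagonal the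
factor r = √3 produces the twist e; on the diagonal the combinations have integer coefficients. -/
theorem dworkCongr_kernelMatrix {O : Type*} [CommRing O] {p : ℕ} [Fact p.Prime] (hp : p ≠ 0)
    (hreg : (p : O) ∈ nonZeroDivisors O) {F : O →+* O} (hF : IsFrobeniusLift p F)
    (h2 : IsUnit (2 : O)) (h3 : IsUnit (3 : O)) {r : O} (hr : r ^ 2 = 3) {e : ℤ} (he : e ^ 2 = 1)
    (hFr : F r = e * r) {s c k d : O⟦X⟧} (hs : 3 * s - 4 * s ^ 3 = X) (hs0 : constantCoeff s = 0)
    (hc : c ^ 2 = 1 - s ^ 2) (hc0 : constantCoeff c = 1) (hk : (1 - 4 * s ^ 2) * k = 1)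
    (hd : c * d = 1) (i j : Fin 2) :
    DworkCongr p (expandMap p hp F) (if i = j then 1 else e) (kernelMatrix s c k d i j) := by
  have hreg' : (p : O⟦X⟧) ∈ nonZeroDivisors O⟦X⟧ := natCast_mem_nonZeroDivisors hreg
  have hdl := dworkCongr_dlog hreg' (hF.expandMap hp)
  have h2' : IsUnit (2 : O⟦X⟧) := by simpa only [map_ofNat] using h2.map (C (R := O))
  have h3' : IsUnit (3 : O⟦X⟧) := by simpa only [map_ofNat] using h3.map (C (R := O))
  have hr' : (C r : O⟦X⟧) ^ 2 = 3 := by rw [← map_pow, hr, map_ofNat]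
  have hru : IsUnit r := by
    rw [← hr] at h3
    exact (isUnit_pow_iff two_ne_zero).1 h3
  have hGr : expandMap p hp F (C r) = e * C r := by
    rw [expandMap_apply, map_C, expand_C, hFr, map_mul, map_intCast]
  have hW := X_sub_C_X_mem_nonZeroDivisors (R := O)
  have hCX : C (X : O⟦X⟧) = 3 * C s - 4 * C s ^ 3 := by
    rw [← hs]; simp only [map_sub, map_mul, map_pow, map_ofNat]
  have hV := X_sub_C_X_mul_kernelMatrix hk hd
  rw [hCX] at hW hV
  have mS := congrArg (PowerSeries.map (C (R := O))) hs
  have mC := congrArg (PowerSeries.map (C (R := O))) hc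
  have mK := congrArg (PowerSeries.map (C (R := O))) hk
  have mD := congrArg (PowerSeries.map (C (R := O))) hd
  have mc := congrArg (C (R := O⟦X⟧)) hc
  simp only [map_sub, map_mul, map_pow, map_ofNat, map_one, map_X] at mS mC mK mD mc
  have dC : ∀ f : O⟦X⟧, d⁄dX O⟦X⟧ (C f) = 0 := fun f => derivative_C
  have mV : ∀ i j, (X - (3 * C s - 4 * C s ^ 3)) * kernelMatrix s c k d i j =
      (trisectionInverse (C s) (C c) * trisectionMatrix (PowerSeries.map (C (R := O)) s)
        (PowerSeries.map C k) (PowerSeries.map C d) - 1) i j := by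
    intro i j
    rw [hV, map_trisectionInverse, map_trisectionMatrix]
  obtain ⟨α, hα, hαm, hαC⟩ := exists_augmentation O
  have aS := hαm s
  have aC := hαm c
  have as := hαC s
  have ac := hαC c
  have ar := hαC (C r)
  rw [hs0] at aS as
  rw [hc0] at aC ac
  rw [constantCoeff_C] at ar
  have ds := dC s
  have dc := dC c
  clear hαm hαC hV dC hs hs0 hc hc0 hk hd hCX
  apply DworkCongr.of_two_mul h2'
  generalize kernelMatrix s c k d = V at *
  generalize PowerSeries.map (C (R := O)) s = S at *
  generalize PowerSeries.map (C (R := O)) c = C' at *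
  generalize PowerSeries.map (C (R := O)) k = K at *
  generalize PowerSeries.map (C (R := O)) d = D at *
  generalize C (R := O⟦X⟧) s = s at *
  generalize C (R := O⟦X⟧) c = c at *
  -- At σ = τ = 0 both sines are 0 and both cosines are 1, so the series below have constant terms
  -- 3, ±√3, 2 and 1, all units.
  obtain ⟨u, hu⟩ := hα (3 - 4 * (S ^ 2 + S * s + s ^ 2)) (by
    simpa [aS, as, map_ofNat α] using h3)
  fin_cases i <;> fin_cases j
  · have h := kernel_zero_zero hW mS ds mK (V := V 0 0) (by
      rw [mV]
      simp [trisectionInverse, trisectionMatrix]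
      ring) u hu
    simp only [Fin.zero_eta, h]
    exact_mod_cast (hdl u).intCast_mul (-3)
  · obtain ⟨v, hv⟩ := hα (S + 2 * s + C (C r) * C') (by
      simpa [aS, as, aC, ar, map_ofNat α] using hru)
    obtain ⟨w, hw⟩ := hα (S + 2 * s - C (C r) * C') (by
      simpa [aS, as, aC, ar, map_ofNat α] using hru)
    have h := kernel_zero_one h2' hW mS ds mC mK mD hr' (V := V 0 1) (by
      rw [mV]
      simp [trisectionInverse, trisectionMatrix]) v w hv hw
    simp only [Fin.zero_eta, Fin.mk_one, h]
    simpa [sub_eq_add_neg] using ((hdl w).add ((hdl v).intCast_mul (-1))).C_mul he hGr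
  · obtain ⟨v, hv⟩ := hα (2 * S + s + C (C r) * c) (by
      simpa [aS, as, ac, ar, map_ofNat α] using hru)
    obtain ⟨w, hw⟩ := hα (2 * S + s - C (C r) * c) (by
      simpa [aS, as, ac, ar, map_ofNat α] using hru)
    have h := kernel_one_zero hW mS ds dc mc mK hr' (V := V 1 0) (by
      rw [mV]
      simp [trisectionInverse, trisectionMatrix]
      ring) v w hv hw
    simp only [Fin.zero_eta, Fin.mk_one, h]
    simpa [sub_eq_add_neg] using ((hdl w).add ((hdl v).intCast_mul (-1))).C_mul he hGr
  · obtain ⟨v, hv⟩ := hα (C' * c - S * s + 1) (by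
      simpa [aS, as, aC, ac, one_add_one_eq_two] using h2)
    obtain ⟨w, hw⟩ := hα (2 * (C' * c - S * s) - 1) (by
      rw [map_sub, map_mul, map_sub, map_mul, map_mul, aS, aC, ac, map_ofNat, map_one]
      norm_num)
    have h := kernel_one_one h2' h3' hW mS ds dc mC mc mK mD (V := V 1 1) (by
      rw [mV]
      simp [trisectionInverse, trisectionMatrix]) u v w hu hv hw
    simp only [Fin.mk_one, h]
    have := (((hdl u).intCast_mul (-3)).add ((hdl v).intCast_mul (-2))).add ((hdl w).intCast_mul 2)
    simpa [sub_eq_add_neg] using this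

/-! ### Adjoining √3 and lifting Frobenius -/

section QuadraticExtension
variable {A : Type*} [CommRing A]

/-- The endomorphism `x + y √a ↦ x + e y √a`. -/
def quadraticTwist (a : A) (e : ℤ) (he : e ^ 2 = 1) : QuadraticAlgebra A a 0 →+* QuadraticAlgebra A a 0 where
  toFun z := ⟨z.re, e * z.im⟩
  map_zero' := by ext <;> simp
  map_one' := by ext <;> simp [QuadraticAlgebra.re_one, QuadraticAlgebra.im_one]
  map_add' x y := by ext <;> simp [mul_add]
  map_mul' x y := by
    have he' : (e : A) ^ 2 = 1 := by exact_mod_cast congrArg (Int.cast (R := A)) he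
    ext
    · simp only [QuadraticAlgebra.re_mul]
      linear_combination (-a * x.im * y.im) * he'
    · simp only [QuadraticAlgebra.im_mul]
      ring

theorem quadraticTwist_algebraMap (a : A) (e : ℤ) (he : e ^ 2 = 1) (x : A) :
    quadraticTwist a e he (algebraMap A _ x) = algebraMap A _ x := by
  ext <;> simp [quadraticTwist, QuadraticAlgebra.algebraMap_eq]

theorem natCast_dvd_quadraticAlgebra {a : A} {n : ℕ} {z : QuadraticAlgebra A a 0} :
    (n : QuadraticAlgebra A a 0) ∣ z ↔ (n : A) ∣ z.re ∧ (n : A) ∣ z.im := by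
  constructor
  · rintro ⟨w, rfl⟩
    simp
  · rintro ⟨⟨x, hx⟩, ⟨y, hy⟩⟩
    refine ⟨⟨x, y⟩, ?_⟩
    ext <;> simp [hx, hy]

theorem quadraticAlgebra_sq (a : A) :
    (⟨0, 1⟩ : QuadraticAlgebra A a 0) ^ 2 = algebraMap A _ a := by
  rw [pow_two]
  ext <;> simp [QuadraticAlgebra.algebraMap_eq]

end QuadraticExtension

theorem PadicInt.dvd_pow_sub_self {p : ℕ} [Fact p.Prime] (x : ℤ_[p]) : (p : ℤ_[p]) ∣ x ^ p - x := by
  rw [← Ideal.mem_span_singleton, ← PadicInt.maximalIdeal_eq_span_p, ← PadicInt.ker_toZMod,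
    RingHom.mem_ker, map_sub, map_pow, ZMod.pow_card, sub_self]

/-- The sign `ε_p`. -/
def epsSign (p : ℕ) : ℤ := open Classical in if IsSquare (3 : ZMod p) then 1 else -1

theorem epsSign_sq (p : ℕ) : epsSign p ^ 2 = 1 := by
  unfold epsSign; split_ifs <;> norm_num

/-- Euler's criterion; `p / 2` is (p - 1)/2 as p is odd. -/
theorem dvd_three_pow_sub_epsSign {p : ℕ} [Fact p.Prime] (hp : 3 < p) :
    (p : ℤ_[p]) ∣ 3 ^ (p / 2) - epsSign p := by
  have h3 : (3 : ZMod p) ≠ 0 := by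
    have : ((3 : ℕ) : ZMod p) ≠ 0 := by
      rw [Ne, ZMod.natCast_eq_zero_iff]
      exact fun h => absurd (Nat.le_of_dvd (by norm_num) h) (by omega)
    exact_mod_cast this
  rw [← Ideal.mem_span_singleton, ← PadicInt.maximalIdeal_eq_span_p, ← PadicInt.ker_toZMod,
    RingHom.mem_ker, map_sub, map_pow, map_ofNat, map_intCast, sub_eq_zero]
  unfold epsSign
  split_ifs with h
  · rw [(ZMod.euler_criterion p h3).1 h]; simp
  · have := (ZMod.pow_div_two_eq_neg_one_or_one p h3).resolve_left
      (fun h' => h ((ZMod.euler_criterion p h3).2 h'))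
    rw [this]; simp

/-- Modulo p, (x + y√3)^p ≡ x^p + y^p 3^((p-1)/2) √3 ≡ x + ε_p y√3, by Fermat and Euler. -/
theorem isFrobeniusLift_quadraticTwist {p : ℕ} [Fact p.Prime] (hp : 3 < p) :
    IsFrobeniusLift p (quadraticTwist (3 : ℤ_[p]) (epsSign p) (epsSign_sq p)) := by
  intro z
  have hP : p.Prime := Fact.out
  set r : QuadraticAlgebra ℤ_[p] 3 0 := ⟨0, 1⟩ with hr
  have hz : z = algebraMap ℤ_[p] _ z.re + algebraMap ℤ_[p] _ z.im * r := by
    ext <;> simp [hr, QuadraticAlgebra.algebraMap_eq]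
  obtain ⟨q, hq⟩ := exists_add_pow_prime_eq hP (algebraMap ℤ_[p] (QuadraticAlgebra ℤ_[p] 3 0) z.re)
    (algebraMap ℤ_[p] _ z.im * r)
  have hodd : p = 2 * (p / 2) + 1 := by
    have := hP.eq_two_or_odd
    omega
  have hrp : r ^ p = algebraMap ℤ_[p] _ (3 ^ (p / 2)) * r := by
    rw [congrArg (r ^ ·) hodd, pow_succ, pow_mul, quadraticAlgebra_sq, map_pow]
  rw [← hz, mul_pow, hrp, ← map_pow, ← map_pow, mul_assoc, mul_assoc] at hq
  have h1 : (p : QuadraticAlgebra ℤ_[p] 3 0) ∣ z ^ p - quadraticTwist (3 : ℤ_[p]) (epsSign p) (epsSign_sq p) z := by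
    rw [hq]
    have : algebraMap ℤ_[p] (QuadraticAlgebra ℤ_[p] 3 0) (z.re ^ p) +
        algebraMap ℤ_[p] _ (z.im ^ p) * (algebraMap ℤ_[p] _ (3 ^ (p / 2)) * r) +
        p * (algebraMap ℤ_[p] _ z.re * (algebraMap ℤ_[p] _ z.im * r * q)) -
        quadraticTwist (3 : ℤ_[p]) (epsSign p) (epsSign_sq p) z =
      p * (algebraMap ℤ_[p] _ z.re * (algebraMap ℤ_[p] _ z.im * r * q)) +
       (⟨z.re ^ p - z.re, z.im ^ p * 3 ^ (p / 2) - epsSign p * z.im⟩ :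
         QuadraticAlgebra ℤ_[p] 3 0) := by
      have : (⟨z.re ^ p - z.re, z.im ^ p * 3 ^ (p / 2) - epsSign p * z.im⟩ :
         QuadraticAlgebra ℤ_[p] 3 0) = algebraMap ℤ_[p] (QuadraticAlgebra ℤ_[p] 3 0) (z.re ^ p) +
        algebraMap ℤ_[p] _ (z.im ^ p) * (algebraMap ℤ_[p] _ (3 ^ (p / 2)) * r) -
        quadraticTwist (3 : ℤ_[p]) (epsSign p) (epsSign_sq p) z := by
        ext <;> simp [hr, QuadraticAlgebra.algebraMap_eq, quadraticTwist]
      rw [this]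
      ring
    rw [this]
    apply dvd_add (dvd_mul_right _ _)
    rw [natCast_dvd_quadraticAlgebra]
    refine ⟨PadicInt.dvd_pow_sub_self _, ?_⟩
    have := dvd_add ((PadicInt.dvd_pow_sub_self z.im).mul_left (3 ^ (p / 2)))
      ((dvd_three_pow_sub_epsSign hp).mul_left z.im)
    convert this using 1
    ring
  rw [← neg_sub]
  exact h1.neg_right

/-- The root √3 is adjoined formally for either value of ε_p. If ℤ_p already contains it, the
algebra is not a domain, so regularity of p is checked on components. -/
theorem natCast_mem_nonZeroDivisors_quadraticAlgebra {p : ℕ} [Fact p.Prime] :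
    (p : QuadraticAlgebra ℤ_[p] 3 0) ∈ nonZeroDivisors (QuadraticAlgebra ℤ_[p] 3 0) := by
  rw [mem_nonZeroDivisors_iff_right]
  intro z hz
  have h1 := congrArg QuadraticAlgebra.re hz
  have h2 := congrArg QuadraticAlgebra.im hz
  have hp : (p : ℤ_[p]) ≠ 0 := by exact_mod_cast (Fact.out : p.Prime).ne_zero
  simp [hp] at h1 h2
  ext <;> simp [h1, h2]

/-- The matrix form of Dwork's congruences for the coefficients of the kernel. -/
theorem pow_dvd_trisection_shift {p : ℕ} [Fact p.Prime] (hp : 3 < p) (hp0 : p ≠ 0)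
    {s c k d : ℤ_[p]⟦X⟧} (hs : 3 * s - 4 * s ^ 3 = X) (hs0 : constantCoeff s = 0)
    (hc : c ^ 2 = 1 - s ^ 2) (hc0 : constantCoeff c = 1) (hk : (1 - 4 * s ^ 2) * k = 1)
    (hd : c * d = 1) {N M : ℕ} (hM : 1 ≤ M) (hN : p ^ N ∣ p * M) (i j : Fin 2) :
    ((p ^ N : ℕ) : ℤ_[p]⟦X⟧) ∣
      (trisectionInverse s c * (trisectionMatrix s k d).map (shift (p * M))) i j -
        ((if i = j then 1 else epsSign p : ℤ) : ℤ_[p]⟦X⟧) * expand p hp0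
          ((trisectionInverse s c * (trisectionMatrix s k d).map (shift M)) i j) := by
  let ι := algebraMap ℤ_[p] (QuadraticAlgebra ℤ_[p] 3 0)
  obtain ⟨n, rfl⟩ : ∃ n, M = n + 1 := ⟨M - 1, by omega⟩
  have hpn : p * (n + 1) - 1 + 1 = p * (n + 1) :=
    Nat.sub_add_cancel (Nat.mul_pos (by omega) n.succ_pos)
  have u2 : IsUnit ((2 : ℕ) : ℤ_[p]) := PadicInt.isUnit_natCast_of_lt (by norm_num) (by omega)
  have u3 : IsUnit ((3 : ℕ) : ℤ_[p]) := PadicInt.isUnit_natCast_of_lt (by norm_num) hp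
  have v2 : IsUnit (2 : QuadraticAlgebra ℤ_[p] 3 0) := by
    simpa only [Nat.cast_ofNat, map_ofNat] using u2.map ι
  have v3 : IsUnit (3 : QuadraticAlgebra ℤ_[p] 3 0) := by
    simpa only [Nat.cast_ofNat, map_ofNat] using u3.map ι
  have m1 := congrArg (PowerSeries.map ι) hs
  have m2 := congrArg (PowerSeries.map ι) hc
  have m3 := congrArg (PowerSeries.map ι) hk
  have m4 := congrArg (PowerSeries.map ι) hd
  simp only [map_sub, map_mul, map_pow, map_ofNat, map_one, map_X] at m1 m2 m3 m4
  have n1 : constantCoeff (PowerSeries.map ι s) = 0 := by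
    rw [← coeff_zero_eq_constantCoeff_apply, coeff_map, coeff_zero_eq_constantCoeff_apply, hs0,
      map_zero]
  have n2 : constantCoeff (PowerSeries.map ι c) = 1 := by
    rw [← coeff_zero_eq_constantCoeff_apply, coeff_map, coeff_zero_eq_constantCoeff_apply, hc0,
      map_one]
  -- The twist fixes ℤ_p, so on series over ℤ_p the Frobenius lift is just t ↦ t^p.
  have hF : (quadraticTwist (3 : ℤ_[p]) (epsSign p) (epsSign_sq p)).comp ι = ι :=
    RingHom.ext fun x => quadraticTwist_algebraMap _ _ (epsSign_sq p) x
  have h := dworkCongr_kernelMatrix hp0 natCast_mem_nonZeroDivisors_quadraticAlgebra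
    (isFrobeniusLift_quadraticTwist hp) v2 v3
    (r := ⟨0, 1⟩) (by rw [quadraticAlgebra_sq, map_ofNat]) (epsSign_sq p)
    (by ext <;> simp [quadraticTwist]) m1 n1 m2 n2 m3 m4 i j N n hN
  have hmap : ∀ L : ℕ, (trisectionInverse (PowerSeries.map ι s) (PowerSeries.map ι c) *
      (trisectionMatrix (PowerSeries.map ι s) (PowerSeries.map ι k) (PowerSeries.map ι d)).map
        (shift L)) i j = PowerSeries.map ι ((trisectionInverse s c *
          (trisectionMatrix s k d).map (shift L)) i j) := by
    intro L
    rw [← map_trisectionInverse, ← map_trisectionMatrix]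
    simp only [Matrix.mul_apply, Matrix.map_apply, map_sum, map_mul, map_shift]
  rw [coeff_kernelMatrix, coeff_kernelMatrix, hpn, hmap, hmap, expandMap_apply,
    ← RingHom.comp_apply (PowerSeries.map _), ← map_comp, hF, ← map_expand,
    ← map_intCast (PowerSeries.map ι), ← map_mul, ← map_sub, ← Nat.cast_pow,
    natCast_dvd_iff_coeff] at h
  rw [natCast_dvd_iff_coeff]
  intro l
  have := h l
  rw [coeff_map, natCast_dvd_quadraticAlgebra] at this
  -- Divisibility descends to ℤ_p through the component free of √3.
  simpa [ι, QuadraticAlgebra.algebraMap_eq] using this.1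

/-! ### From shifts to truncations -/

section truncation
variable {R : Type*} [CommRing R]

theorem isUnit_matrix_of_constantCoeff {A : Matrix (Fin 2) (Fin 2) R⟦X⟧}
    (h : ∀ i j, constantCoeff (A i j) = if i = j then 1 else 0) : IsUnit A := by
  rw [Matrix.isUnit_iff_isUnit_det, isUnit_iff_constantCoeff, Matrix.det_fin_two]
  simp [h]

theorem truncMatrix_eq (N : ℕ) (A : Matrix (Fin 2) (Fin 2) R⟦X⟧) :
    truncMatrix N A = A - (X ^ N : R⟦X⟧) • A.map (shift N) := by
  refine Matrix.ext fun i j => ?_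
  have := eq_X_pow_mul_shift_add_trunc N (A i j)
  simp only [truncMatrix, Matrix.map_apply, Matrix.sub_apply, Matrix.smul_apply, smul_eq_mul,
    shift]
  exact eq_sub_of_add_eq' this.symm

theorem constantCoeff_truncMatrix {N : ℕ} (hN : 1 ≤ N) (A : Matrix (Fin 2) (Fin 2) R⟦X⟧)
    (i j : Fin 2) : constantCoeff (truncMatrix N A i j) = constantCoeff (A i j) := by
  rw [← coeff_zero_eq_constantCoeff_apply, truncMatrix, Matrix.map_apply,
    coeff_coe_trunc_of_lt hN, coeff_zero_eq_constantCoeff_apply]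

/-- Dwork's congruences for the truncations of `Y` follow from those for `Y⁻¹ * shift Y`. -/
theorem matrixCongr_of_shift {p : ℕ} (hp : p ≠ 0) {q M : ℕ}
    {Y Z E : Matrix (Fin 2) (Fin 2) R⟦X⟧} (hZ : Z * Y = 1)
    (hY : ∀ i j, constantCoeff (Y i j) = if i = j then 1 else 0)
    (hM : 1 ≤ M)
    (h : ∀ i j, (q : R⟦X⟧) ∣ (Z * Y.map (shift (p * M)) * E -
      E * expandMatrix p hp (Z * Y.map (shift M))) i j) :
    IsUnit (expandMatrix p hp Y) ∧ IsUnit (expandMatrix p hp (truncMatrix M Y)) ∧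
      MatrixCongr q (truncMatrix (p * M) Y * E * (expandMatrix p hp (truncMatrix M Y))⁻¹)
        (Y * E * (expandMatrix p hp Y)⁻¹) := by
  have u1 : IsUnit (expandMatrix p hp Y) :=
    isUnit_matrix_of_constantCoeff fun i j => by simp [expandMatrix, hY]
  have u2 : IsUnit (expandMatrix p hp (truncMatrix M Y)) :=
    isUnit_matrix_of_constantCoeff fun i j => by
      rw [expandMatrix, Matrix.map_apply, constantCoeff_expand, constantCoeff_truncMatrix hM, hY]
  refine ⟨u1, u2, ?_⟩
  choose T hT using h
  have hYZ : Y * Z = 1 := mul_eq_one_comm.1 hZ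
  let V : ℕ → Matrix (Fin 2) (Fin 2) R⟦X⟧ := fun N => Z * Y.map (shift N)
  have hV : ∀ N, Y.map (shift N) = Y * V N := fun N => by
    rw [← Matrix.mul_assoc, hYZ, Matrix.one_mul]
  have hT' : V (p * M) * E = E * expandMatrix p hp (V M) + (q : R⟦X⟧) • Matrix.of T := by
    rw [← sub_eq_iff_eq_add']
    refine Matrix.ext fun i j => ?_
    exact hT i j
  have h1 : expandMatrix p hp (truncMatrix M Y) =
      expandMatrix p hp Y * (1 - (X ^ (p * M) : R⟦X⟧) • expandMatrix p hp (V M)) := by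
    rw [truncMatrix_eq, hV, Matrix.mul_sub, Matrix.mul_one, Matrix.mul_smul]
    refine Matrix.ext fun i j => ?_
    simp [expandMatrix, Matrix.mul_apply, pow_mul]
  -- Up to a multiple of q, the right factor here is the one in `h1`, so it cancels in the quotient.
  have h2 : truncMatrix (p * M) Y * E =
      Y * E * (1 - (X ^ (p * M) : R⟦X⟧) • expandMatrix p hp (V M)) -
        (q : R⟦X⟧) • (X ^ (p * M) : R⟦X⟧) • (Y * Matrix.of T) := by
    rw [truncMatrix_eq, hV, Matrix.sub_mul, Matrix.smul_mul, Matrix.mul_assoc Y (V _), hT',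
      Matrix.mul_add, Matrix.mul_sub, Matrix.mul_one, Matrix.mul_smul, Matrix.mul_smul, smul_add,
      Matrix.mul_assoc Y E, sub_sub, smul_comm (q : R⟦X⟧)]
  have h3 : 1 - (X ^ (p * M) : R⟦X⟧) • expandMatrix p hp (V M) =
      (expandMatrix p hp Y)⁻¹ * expandMatrix p hp (truncMatrix M Y) := by
    rw [h1, ← Matrix.mul_assoc,
      Matrix.nonsing_inv_mul _ ((Matrix.isUnit_iff_isUnit_det _).1 u1), Matrix.one_mul]
  have h4 : truncMatrix (p * M) Y * E * (expandMatrix p hp (truncMatrix M Y))⁻¹ -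
      Y * E * (expandMatrix p hp Y)⁻¹ = (q : R⟦X⟧) • (-((X ^ (p * M) : R⟦X⟧) •
        (Y * Matrix.of T * (expandMatrix p hp (truncMatrix M Y))⁻¹))) := by
    rw [h2, h3, Matrix.sub_mul, Matrix.smul_mul, Matrix.smul_mul, Matrix.mul_assoc (Y * E),
      Matrix.mul_assoc (expandMatrix p hp Y)⁻¹,
      Matrix.mul_nonsing_inv _ ((Matrix.isUnit_iff_isUnit_det _).1 u2), Matrix.mul_one, smul_neg]
    abel
  intro i j
  rw [← Matrix.sub_apply, h4, Matrix.smul_apply, smul_eq_mul]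
  exact dvd_mul_right _ _

end truncation

/-! ### The sign matrix and the conclusion -/

theorem epsMatrix_eq (p : ℕ) (R : Type*) [CommRing R] :
    epsMatrix p R = !![((epsSign p : ℤ) : R⟦X⟧), 0; 0, 1] := by
  unfold epsMatrix epsSign
  split_ifs <;> simp

/-- With ε₀ = ε_p and ε₁ = 1, the hypothesis says V_ij ≡ ε_i ε_j W_ij(t^p). Multiplying by ε_j,
whose square is 1, gives the matrix form. -/
theorem dvd_mul_epsMatrix_sub {R : Type*} [CommRing R] {p : ℕ} (hp : p ≠ 0) {q : R⟦X⟧}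
    {V W : Matrix (Fin 2) (Fin 2) R⟦X⟧}
    (h : ∀ i j, q ∣ V i j - ((if i = j then 1 else epsSign p : ℤ) : R⟦X⟧) * expand p hp (W i j))
    (i j : Fin 2) : q ∣ (V * epsMatrix p R - epsMatrix p R * expandMatrix p hp W) i j := by
  have hsq : ((epsSign p : ℤ) : R⟦X⟧) ^ 2 = 1 := by
    exact_mod_cast congrArg (Int.cast (R := R⟦X⟧)) (epsSign_sq p)
  have h' := h i j
  have h'' := (h i j).mul_left ((epsSign p : ℤ) : R⟦X⟧)
  rw [epsMatrix_eq]
  fin_cases i <;> fin_cases j <;>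
    simp [Matrix.vecMul, dotProduct, Matrix.mul_apply, Fin.sum_univ_two, expandMatrix] at h' h'' ⊢
  · convert h'' using 1; ring
  · exact h'
  · convert h'' using 1; linear_combination (expand p hp (W 1 0)) * hsq
  · exact h'

theorem theorem1 (p : ℕ) [Fact p.Prime] (hp : 3 < p) :
    ∃ Y : Matrix (Fin 2) (Fin 2) ℤ_[p]⟦X⟧,
      Y.map (PowerSeries.map (PadicInt.Coe.ringHom (p := p))) =
        hyperMatrix.map (PowerSeries.map (algebraMap ℚ ℚ_[p])) ∧
      IsUnit (expandMatrix p (Nat.Prime.ne_zero Fact.out) Y) ∧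
      ∀ m s : ℕ, 1 ≤ m → 1 ≤ s →
        IsUnit (expandMatrix p (Nat.Prime.ne_zero Fact.out) (truncMatrix (m * p ^ (s - 1)) Y)) ∧
        MatrixCongr (p ^ s)
          (truncMatrix (m * p ^ s) Y * epsMatrix p ℤ_[p] *
            (expandMatrix p (Nat.Prime.ne_zero Fact.out) (truncMatrix (m * p ^ (s - 1)) Y))⁻¹)
          (Y * epsMatrix p ℤ_[p] * (expandMatrix p (Nat.Prime.ne_zero Fact.out) Y)⁻¹) := by
  have hp0 : p ≠ 0 := Nat.Prime.ne_zero Fact.out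
  have u2 : IsUnit (2 : ℤ_[p]) := by
    simpa using PadicInt.isUnit_natCast_of_lt (p := p) (n := 2) (by norm_num) (by omega)
  have u3 : IsUnit (3 : ℤ_[p]) := by
    simpa using PadicInt.isUnit_natCast_of_lt (p := p) (n := 3) (by norm_num) hp
  obtain ⟨s, hs, hs0⟩ := exists_trisected_sine u2 u3
  obtain ⟨c, hc, hc0⟩ := exists_sqrt_one_sub_sq u2 hs0
  obtain ⟨k, hk⟩ := IsUnit.exists_right_inv (a := 1 - 4 * s ^ 2) (by
    rw [isUnit_iff_constantCoeff]; simp [hs0])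
  obtain ⟨d, hd⟩ := IsUnit.exists_right_inv (a := c) (by
    rw [isUnit_iff_constantCoeff, hc0]; exact isUnit_one)
  have hk0 : constantCoeff k = 1 := by
    have := congrArg constantCoeff hk
    simpa [hs0] using this
  have hd0 : constantCoeff d = 1 := by
    have := congrArg constantCoeff hd
    simpa [hc0] using this
  have hY : ∀ i j, constantCoeff (trisectionMatrix s k d i j) = if i = j then 1 else 0 := by
    intro i j
    fin_cases i <;> fin_cases j <;> simp [trisectionMatrix, hs0, hk0, hd0]
  have hmain : ∀ m s' : ℕ, 1 ≤ m → 1 ≤ s' → _ := fun m s' hm hs' =>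
    matrixCongr_of_shift (E := epsMatrix p ℤ_[p]) hp0 (q := p ^ s') (M := m * p ^ (s' - 1))
      (trisectionInverse_mul hk hd) hY
      (Nat.mul_pos hm (pow_pos (Nat.pos_of_ne_zero hp0) _)) (by
        have hpow : p * (m * p ^ (s' - 1)) = m * p ^ s' := by
          rw [mul_left_comm, ← pow_succ', Nat.sub_add_cancel hs']
        have h := pow_dvd_trisection_shift hp hp0 hs hs0 hc hc0 hk hd (N := s')
          (M := m * p ^ (s' - 1)) (Nat.mul_pos hm (pow_pos (Nat.pos_of_ne_zero hp0) _))
          (hpow ▸ Dvd.intro_left m rfl)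
        exact dvd_mul_epsMatrix_sub hp0 h)
  refine ⟨trisectionMatrix s k d, ?_, (hmain 1 1 le_rfl le_rfl).1, fun m s' hm hs' => ?_⟩
  -- Over ℚ_p both matrices solve the system columnwise with the same constant terms, so uniqueness
  -- identifies them.
  · have hsol := fun j => (isSolution_trisectionMatrix u2 hs hc hk hd j).map
      (PadicInt.Coe.ringHom (p := p))
    have hcc : ∀ i j, constantCoeff (PowerSeries.map (PadicInt.Coe.ringHom (p := p))
        (trisectionMatrix s k d i j)) =
        constantCoeff (PowerSeries.map (algebraMap ℚ ℚ_[p]) (hyperMatrix i j)) := fun i j => by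
      rw [← coeff_zero_eq_constantCoeff_apply, coeff_map, coeff_zero_eq_constantCoeff_apply, hY,
        ← coeff_zero_eq_constantCoeff_apply, coeff_map, coeff_zero_eq_constantCoeff_apply,
        constantCoeff_hyperMatrix]
      split_ifs <;> simp
    have h0 := (hsol 0).unique (isSolution_hyperMatrix_left.map (algebraMap ℚ ℚ_[p]))
      (hcc 0 0) (hcc 1 0)
    have h1 := (hsol 1).unique (isSolution_hyperMatrix_right.map (algebraMap ℚ ℚ_[p]))
      (hcc 0 1) (hcc 1 1)
    refine Matrix.ext fun i j => ?_
    fin_cases i <;> fin_cases j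
    exacts [h0.1, h1.1, h0.2, h1.2]
  · have := (hmain m s' hm hs').2
    have hpow : p * (m * p ^ (s' - 1)) = m * p ^ s' := by
      rw [mul_left_comm, ← pow_succ', Nat.sub_add_cancel hs']
    rwa [hpow] at this
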